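/- \textbf{Setting.} Let $\Gamma$ be a metric graph with finitely many internal edges of lengths $\ell_j>0$ and finitely many external edges (half-lines), carrying the Hamiltonian $H=-\frac{d^2}{dx^2}$ on the functions that lie in $W^{2,2}$ on every edge and satisfy at each vertex $v$ a coupling condition $(U_v-I)\Psi_v+i(U_v+I)\Psi_v'=0$. Here $U_v$ is a unitary matrix whose size is the degree of $v$, $\Psi_v$ is the vector of boundary values at $v$, and $\Psi_v'$ is the vector of outgoing derivatives at $v$. For $k\in\mathbb C$, the effective vertex-scattering matrix $\tilde\sigma^{(v)}(k)$ is the matrix mapping $a^{\rm in}$ to $a^{\rm out}$ for the waves $a_j^{\rm in}e^{-ikx}+a_j^{\rm out}e^{ikx}$ on the internal edges and $b_se^{ikx}$ on the half-lines at $v$ (all parametrized from $v$) that satisfy the coupling condition at $v$. Each internal edge is replaced by two oppositely oriented bonds. For bonds $b,b'$, let $S_{b'b}(k)$ be the entry of $\tilde\sigma^{(v)}(k)$ for scattering from $b$ into $b'$ if $b$ ends and $b'$ starts at the same vertex $v$, and let $S_{b'b}(k)=0$ otherwise. A periodic orbit is a nonempty closed path of bonds $\gamma=(b_1,\dots,b_n)$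 up to cyclic permutation, with $A_\gamma=S_{b_2b_1}S_{b_3b_2}\cdots S_{b_1b_n}$ and $\ell_\gamma=\sum_j\ell_{b_j}$. An irreducible pseudo-orbit $\bar\gamma$ is a finite (possibly empty) collection of $m_{\bar\gamma}$ periodic orbits in which no bond occurs more than once. $A_{\bar\gamma}$ is the product of the $A_\gamma$, and $\ell_{\bar\gamma}$ is the sum of the $\ell_\gamma$, over its periodic orbits. All sums below run over the irreducible pseudo-orbits. The resonance condition is $$\sum_{\bar\gamma}(-1)^{m_{\bar\gamma}}A_{\bar\gamma}(k)\,e^{ik\ell_{\bar\gamma}}=0.\qquad(*)$$ \textbf{Statement.} Let the lengths $\ell_j=\ell_j(t)$ be $C^2$ near $t=0$ with $\ell_j(0)>0$, let $k_0>0$, and let $k_0^2$ be an eigenvalue of $H$ at $t=0$ (it is embedded in the continuous spectrum as soon as there is a half-line). Suppose that every $A_{\bar\gamma}(k)$ is real and independent of $k$ for $k$ in a neighbourhood of $k_0$. At $t=0$ and $k=k_0$ put $$C=\sum_{\bar\gamma}\ell_{\bar\gamma}(-1)^{m_{\bar\gamma}}A_{\bar\gamma}\cos k\ell_{\bar\gamma},\qquad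 S=\sum_{\bar\gamma}\ell_{\bar\gamma}(-1)^{m_{\bar\gamma}}A_{\bar\gamma}\sin k\ell_{\bar\gamma},\qquad d=C^2+S^2,$$ and suppose $d\neq0$ (that is, $k_0$ is a simple zero of the left-hand side of $(*)$ at $t=0$). Then there are $\varepsilon,\delta>0$ such that for $|t|<\varepsilon$ the condition $(*)$ has exactly one solution $k(t)$ with $|k(t)-k_0|<\delta$. Moreover $k(0)=k_0$, $k$ is $C^2$ near $t=0$, $\dot k(0)$ is real, and with all quantities taken at $t=0$ (dots denote $t$-derivatives) $$C\,\dot k=-k\sum_{\bar\gamma}\dot\ell_{\bar\gamma}(-1)^{m_{\bar\gamma}}A_{\bar\gamma}\cos k\ell_{\bar\gamma},$$ so that if $C\ne0$, $$\dot k=-k\,\frac{\sum_{\bar\gamma}\dot\ell_{\bar\gamma}(-1)^{m_{\bar\gamma}}A_{\bar\gamma}\cos k\ell_{\bar\gamma}}{\sum_{\bar\gamma}\ell_{\bar\gamma}(-1)^{m_{\bar\gamma}}A_{\bar\gamma}\cos k\ell_{\bar\gamma}};$$ and $$\mathrm{Im}\,\ddot k=-\frac{C}{d}\,B_1+\frac{S}{d}\,B_2,\qquad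 \mathrm{Re}\,\ddot k=-\frac{S}{d}\,B_1-\frac{C}{d}\,B_2,$$ where $$B_1=2\dot k\sum_{\bar\gamma}(k\dot\ell_{\bar\gamma}\ell_{\bar\gamma}\cos k\ell_{\bar\gamma}+\dot\ell_{\bar\gamma}\sin k\ell_{\bar\gamma})(-1)^{m_{\bar\gamma}}A_{\bar\gamma}+\dot k^2\sum_{\bar\gamma}\ell_{\bar\gamma}^2(-1)^{m_{\bar\gamma}}A_{\bar\gamma}\cos k\ell_{\bar\gamma}+k\sum_{\bar\gamma}(k\dot\ell_{\bar\gamma}^2\cos k\ell_{\bar\gamma}+\ddot\ell_{\bar\gamma}\sin k\ell_{\bar\gamma})(-1)^{m_{\bar\gamma}}A_{\bar\gamma},$$ $$B_2=2\dot k\sum_{\bar\gamma}(-k\dot\ell_{\bar\gamma}\ell_{\bar\gamma}\sin k\ell_{\bar\gamma}+\dot\ell_{\bar\gamma}\cos k\ell_{\bar\gamma})(-1)^{m_{\bar\gamma}}A_{\bar\gamma}-\dot k^2\sum_{\bar\gamma}\ell_{\bar\gamma}^2(-1)^{m_{\bar\gamma}}A_{\bar\gamma}\sin k\ell_{\bar\gamma}+k\sum_{\bar\gamma}(\ddot\ell_{\bar\gamma}\cos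 k\ell_{\bar\gamma}-k\dot\ell_{\bar\gamma}^2\sin k\ell_{\bar\gamma})(-1)^{m_{\bar\gamma}}A_{\bar\gamma}.$$ The assumption on the coefficients holds in particular for the standard coupling, $U_v=\frac{2}{\deg v}J-I$ at every vertex $v$ ($J$ the matrix with all entries $1$): then all $A_{\bar\gamma}(k)$, $k\neq0$, are real and independent of $k$. -/

import Mathlib

open Filter Topology MeasureTheory

/-- The combinatorial part of a metric graph with leads.  `V` is the set of vertices, `E` the set of
internal edges, `X` the set of external semi-infinite edges (leads).  An internal edge `e` is
identified with an interval `(0, ℓ e)`; its end at `x = 0` is `(e, false)` and its end at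
`x = ℓ e` is `(e, true)`.  Loops and multiple edges are allowed. -/
structure LeadGraph (V E X : Type*) where
  /-- the vertex at which an end of an internal edge is located -/
  vertexOf : E × Bool → V
  /-- the vertex at which a lead is attached -/
  leadVertex : X → V

namespace LeadGraph

variable {V E X : Type*} [DecidableEq V] [Fintype E] [DecidableEq E] [Fintype X] [DecidableEq X]

/-- The ends of internal edges located at the vertex `v`. -/
abbrev IntEnd (G : LeadGraph V E X) (v : V) : Type _ := {p : E × Bool // G.vertexOf p = v}

/-- The leads attached at the vertex `v`. -/
abbrev ExtEnd (G : LeadGraph V E X) (v : V) : Type _ := {x : X // G.leadVertex x = v}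

/-- All edge ends at the vertex `v`; their number is the degree of `v`. -/
abbrev VertexEnd (G : LeadGraph V E X) (v : V) : Type _ := G.IntEnd v ⊕ G.ExtEnd v

/-- A general self-adjoint vertex coupling: a unitary matrix at each vertex. -/
structure Coupling (G : LeadGraph V E X) where
  /-- the coupling matrix at a vertex -/
  U : ∀ v, Matrix (G.VertexEnd v) (G.VertexEnd v) ℂ
  unitary : ∀ v, U v ∈ Matrix.unitaryGroup (G.VertexEnd v) ℂ

variable {G : LeadGraph V E X}

/-- The coupling condition `(U - I) Ψ + i (U + I) Ψ' = 0` at the vertex `v`, for the vector `Ψ` of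
boundary values and the vector `Ψ'` of outgoing derivatives. -/
def Coupling.Holds (W : G.Coupling) (v : V) (Ψ Ψ' : G.VertexEnd v → ℂ) : Prop :=
  (W.U v - 1).mulVec Ψ + Complex.I • (W.U v + 1).mulVec Ψ' = 0

/-- The standard (Kirchhoff) coupling at every vertex: `U = (2 / d) J - I`, with `d` the degree. -/
def Coupling.IsStandard (W : G.Coupling) : Prop :=
  ∀ v, W.U v = (2 / (Fintype.card (G.VertexEnd v) : ℂ)) • Matrix.of (fun _ _ => (1 : ℂ)) - 1

/-! ### The Hamiltonian and its eigenvalues -/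

/-- `f` belongs to the Sobolev space `W^{2,2}` of the interval `I` (of the form `[0, ℓ]` or
`[0, ∞)`), with first derivative `f₁` and second derivative `f₂`: `f` and `f₁` are the (locally)
absolutely continuous representatives, and `f`, `f₁`, `f₂` are square integrable. -/
structure IsW22On (I : Set ℝ) (f f₁ f₂ : ℝ → ℂ) : Prop where
  memLp_zero : MemLp f 2 (volume.restrict I)
  memLp_one : MemLp f₁ 2 (volume.restrict I)
  memLp_two : MemLp f₂ 2 (volume.restrict I)
  eq_integral : ∀ x ∈ I, f x = f 0 + ∫ y in (0 : ℝ)..x, f₁ y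
  eq_integral_deriv : ∀ x ∈ I, f₁ x = f₁ 0 + ∫ y in (0 : ℝ)..x, f₂ y

/-- The boundary values at the vertex `v` of the function with components `f` on the internal edges
(of lengths `ℓ`) and `g` on the leads. -/
def bdryValue (G : LeadGraph V E X) (ℓ : E → ℝ) (f : E → ℝ → ℂ) (g : X → ℝ → ℂ) (v : V) :
    G.VertexEnd v → ℂ
  | Sum.inl p => if p.1.2 then f p.1.1 (ℓ p.1.1) else f p.1.1 0
  | Sum.inr x => g x.1 0

/-- The outgoing derivatives at the vertex `v`, computed from the derivatives `f₁` on the internal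
edges and `g₁` on the leads. -/
def bdryDeriv (G : LeadGraph V E X) (ℓ : E → ℝ) (f₁ : E → ℝ → ℂ) (g₁ : X → ℝ → ℂ) (v : V) :
    G.VertexEnd v → ℂ
  | Sum.inl p => if p.1.2 then -f₁ p.1.1 (ℓ p.1.1) else f₁ p.1.1 0
  | Sum.inr x => g₁ x.1 0

/-- The function with components `f` on the internal edges and `g` on the leads (with first and
second derivatives `f₁`, `g₁` and `f₂`, `g₂`) lies in the domain of the Hamiltonian
`H = -d²/dx²`: it is in `W^{2,2}` on every edge and satisfies the coupling conditions. -/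
structure Coupling.InDomain (W : G.Coupling) (ℓ : E → ℝ)
    (f f₁ f₂ : E → ℝ → ℂ) (g g₁ g₂ : X → ℝ → ℂ) : Prop where
  internal : ∀ e, IsW22On (Set.Icc 0 (ℓ e)) (f e) (f₁ e) (f₂ e)
  external : ∀ x, IsW22On (Set.Ici 0) (g x) (g₁ x) (g₂ x)
  coupling : ∀ v, W.Holds v (G.bdryValue ℓ f g v) (G.bdryDeriv ℓ f₁ g₁ v)

/-- `lam` is an eigenvalue of the Hamiltonian `H` of the graph with edge lengths `ℓ`: there is a
nonzero `ψ` in the domain of `H` (a subspace of `L²`) with `H ψ = -ψ'' = lam ψ`. -/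
def Coupling.IsEigenvalue (W : G.Coupling) (ℓ : E → ℝ) (lam : ℝ) : Prop :=
  ∃ (f f₁ f₂ : E → ℝ → ℂ) (g g₁ g₂ : X → ℝ → ℂ),
    W.InDomain ℓ f f₁ f₂ g g₁ g₂ ∧
    (∀ e, ∀ᵐ x ∂volume.restrict (Set.Icc 0 (ℓ e)), -f₂ e x = (lam : ℂ) * f e x) ∧
    (∀ j, ∀ᵐ x ∂volume.restrict (Set.Ici (0 : ℝ)), -g₂ j x = (lam : ℂ) * g j x) ∧
    ¬ ((∀ e, ∀ᵐ x ∂volume.restrict (Set.Icc 0 (ℓ e)), f e x = 0) ∧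
       (∀ j, ∀ᵐ x ∂volume.restrict (Set.Ici (0 : ℝ)), g j x = 0))

/-! ### Effective vertex scattering -/

/-- `σ` is the effective vertex-scattering matrix at `v` for the momentum `z`.  With all edges at
`v` parametrised from `v`, consider the waves `ain_j e^{-izx} + aout_j e^{izx}` on the internal
edges and `b_s e^{izx}` on the leads; they satisfy the coupling condition at `v` for some
amplitudes `b` exactly if `aout = σ ain`. -/
def Coupling.IsEffScattering (W : G.Coupling) (v : V) (z : ℂ)
    (σ : Matrix (G.IntEnd v) (G.IntEnd v) ℂ) : Prop :=
  ∀ ain aout : G.IntEnd v → ℂ,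
    (∃ b : G.ExtEnd v → ℂ,
      W.Holds v (Sum.elim (fun p => ain p + aout p) b)
        (Sum.elim (fun p => Complex.I * z * (aout p - ain p)) (fun s => Complex.I * z * b s)))
      ↔ aout = σ.mulVec ain

theorem Coupling.IsEffScattering.unique {W : G.Coupling} {v : V} {z : ℂ}
    {σ τ : Matrix (G.IntEnd v) (G.IntEnd v) ℂ}
    (hσ : W.IsEffScattering v z σ) (hτ : W.IsEffScattering v z τ) : σ = τ := by
  refine Matrix.ext_of_mulVec_single fun i => ?_
  exact (hτ _ _).1 ((hσ (Pi.single i 1) _).2 rfl)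

open scoped ComplexOrder in
theorem Coupling.det_ne_zero (W : G.Coupling) (v : V) {z : ℂ} (hz : 0 < z.re) :
    ((1 - z) • W.U v - (1 + z) • (1 : Matrix (G.VertexEnd v) (G.VertexEnd v) ℂ)).det ≠ 0 := by
  intro h0
  obtain ⟨x, hx0, hx⟩ := Matrix.exists_mulVec_eq_zero_iff.2 h0
  have h1 : (1 - z) • (W.U v).mulVec x = (1 + z) • x := by
    rw [Matrix.sub_mulVec, Matrix.smul_mulVec, Matrix.smul_mulVec, Matrix.one_mulVec,
      sub_eq_zero] at hx
    exact hx
  have hU : star ((W.U v).mulVec x) ⬝ᵥ ((W.U v).mulVec x) = star x ⬝ᵥ x := by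
    rw [Matrix.star_mulVec, Matrix.dotProduct_mulVec, Matrix.vecMul_vecMul]
    have := (Matrix.mem_unitaryGroup_iff').1 (W.unitary v)
    rw [Matrix.star_eq_conjTranspose] at this
    rw [this, Matrix.vecMul_one]
  have h2 := congrArg (fun y => star y ⬝ᵥ y) h1
  simp only [star_smul, smul_dotProduct, dotProduct_smul, hU, smul_eq_mul] at h2
  have hne : star x ⬝ᵥ x ≠ 0 := fun h =>
    hx0 (dotProduct_star_self_eq_zero.1 h)
  have h3 : star (1 - z) * (1 - z) = star (1 + z) * (1 + z) := by
    apply mul_right_cancel₀ hne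
    linear_combination h2
  have h4 := congrArg Complex.re h3
  simp at h4
  nlinarith

/-- The effective vertex-scattering matrix exists for every `z` in the right half-plane. -/
theorem Coupling.exists_isEffScattering (W : G.Coupling) (v : V) {z : ℂ} (hz : 0 < z.re) :
    ∃ σ, W.IsEffScattering v z σ := by
  set M := (1 - z) • W.U v - (1 + z) • (1 : Matrix (G.VertexEnd v) (G.VertexEnd v) ℂ) with hM
  set N := (1 + z) • W.U v - (1 - z) • (1 : Matrix (G.VertexEnd v) (G.VertexEnd v) ℂ) with hN
  have hdet : IsUnit M.det := (W.det_ne_zero v hz).isUnit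
  refine ⟨(-(M⁻¹ * N)).toBlocks₁₁, fun ain aout => ?_⟩
  have key : ∀ b : G.ExtEnd v → ℂ,
      W.Holds v (Sum.elim (fun p => ain p + aout p) b)
        (Sum.elim (fun p => Complex.I * z * (aout p - ain p)) (fun s => Complex.I * z * b s)) ↔
      Sum.elim aout b = (-(M⁻¹ * N)).mulVec (Sum.elim ain 0) := by
    intro b
    have e1 : Sum.elim (fun p => ain p + aout p) b
        = (Sum.elim aout b + Sum.elim ain 0 : G.VertexEnd v → ℂ) := by
      ext (p | p) <;> simp [add_comm]
    have e2 : Sum.elim (fun p => Complex.I * z * (aout p - ain p)) (fun s => Complex.I * z * b s)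
        = ((Complex.I * z) • (Sum.elim aout b - Sum.elim ain 0) : G.VertexEnd v → ℂ) := by
      ext (p | p) <;> simp
    have e3 : (W.U v - 1).mulVec (Sum.elim aout b + Sum.elim ain 0)
        + Complex.I • (W.U v + 1).mulVec
            ((Complex.I * z) • (Sum.elim aout b - Sum.elim ain 0))
        = M.mulVec (Sum.elim aout b) + N.mulVec (Sum.elim ain 0) := by
      rw [Matrix.mulVec_smul, smul_smul, ← mul_assoc, Complex.I_mul_I, hM, hN]
      simp only [Matrix.sub_mulVec, Matrix.add_mulVec, Matrix.smul_mulVec, Matrix.one_mulVec,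
        Matrix.mulVec_add, Matrix.mulVec_sub]
      module
    rw [Coupling.Holds, e1, e2, e3, Matrix.neg_mulVec, ← Matrix.mulVec_mulVec]
    constructor
    · intro h
      have h' := congrArg (M⁻¹).mulVec h
      rw [Matrix.mulVec_add, Matrix.mulVec_mulVec, Matrix.nonsing_inv_mul _ hdet,
        Matrix.one_mulVec, Matrix.mulVec_zero] at h'
      exact eq_neg_of_add_eq_zero_left h'
    · intro h
      rw [h, Matrix.mulVec_neg, Matrix.mulVec_mulVec, Matrix.mul_nonsing_inv _ hdet,
        Matrix.one_mulVec, neg_add_cancel]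
  have hblk : ∀ p, (-(M⁻¹ * N)).mulVec (Sum.elim ain 0) (Sum.inl p)
      = ((-(M⁻¹ * N)).toBlocks₁₁).mulVec ain p := by
    intro p
    simp [Matrix.mulVec, dotProduct, Matrix.toBlocks₁₁]
  simp_rw [key]
  constructor
  · rintro ⟨b, hb⟩
    ext p
    rw [← hblk, ← hb, Sum.elim_inl]
  · intro h
    refine ⟨fun s => (-(M⁻¹ * N)).mulVec (Sum.elim ain 0) (Sum.inr s), ?_⟩
    ext (p | p)
    · rw [hblk, Sum.elim_inl, h]
    · rw [Sum.elim_inr]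

/-- The effective vertex-scattering matrix at `v` (it exists for `0 < z.re`, and it is unique
whenever it exists). -/
noncomputable def Coupling.effScattering (W : G.Coupling) (v : V) (z : ℂ) :
    Matrix (G.IntEnd v) (G.IntEnd v) ℂ :=
  Classical.epsilon (W.IsEffScattering v z)

/-! ### Bonds and the bond scattering matrix -/

/-- The bonds (oriented internal edges): the bond `b` runs along the edge `b.1` from the end `b` to
the opposite end. -/
abbrev Bond (_G : LeadGraph V E X) : Type _ := E × Bool

/-- The end at which a bond arrives. -/
def Bond.head (b : G.Bond) : E × Bool := (b.1, !b.2)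

/-- The reversed bond. -/
def Bond.reverse (b : G.Bond) : G.Bond := (b.1, !b.2)

/-- The matrix `Σ̃`: the direct sum of the effective vertex-scattering matrices, where the edge ends
at a vertex are labelled by the bonds arriving there. -/
noncomputable def Coupling.sigmaMatrix (W : G.Coupling) (z : ℂ) : Matrix G.Bond G.Bond ℂ :=
  fun c b =>
    if h : G.vertexOf (Bond.head b) = G.vertexOf (Bond.head c) then
      W.effScattering (G.vertexOf (Bond.head c)) z ⟨Bond.head c, rfl⟩ ⟨Bond.head b, h⟩
    else 0

/-- The scattering matrix `S = Q Σ̃`, where the permutation matrix `Q` interchanges a bond and its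
reverse. -/
noncomputable def Coupling.bondScattering (W : G.Coupling) (z : ℂ) : Matrix G.Bond G.Bond ℂ :=
  fun c b => W.sigmaMatrix z (Bond.reverse c) b

/-! ### Periodic orbits and pseudo-orbits -/

/-- A periodic orbit: a nonempty closed path of bonds, each of which starts at the vertex where the
previous one arrives, up to cyclic permutation. -/
def PeriodicOrbit (G : LeadGraph V E X) : Type _ :=
  {c : Cycle G.Bond // c ≠ Cycle.nil ∧
    c.Chain (fun b b' => G.vertexOf (Bond.head b) = G.vertexOf b')}

/-- The bonds of a periodic orbit, with multiplicity. -/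
def PeriodicOrbit.bonds (c : G.PeriodicOrbit) : Multiset G.Bond := c.1.toMultiset

/-- The metric length of a periodic orbit. -/
def PeriodicOrbit.length (c : G.PeriodicOrbit) (ℓ : E → ℝ) : ℝ :=
  (c.bonds.map fun b => ℓ b.1).sum

/-- The product `S_{b₂ b₁} S_{b₃ b₂} ⋯ S_{b₁ bₙ}` along a cycle `(b₁, …, bₙ)`. -/
def cycleProd {B : Type*} (S : Matrix B B ℂ) (c : Cycle B) : ℂ :=
  Quotient.liftOn c (fun l => (List.zipWith (fun b b' => S b' b) l (l.rotate 1)).prod) (by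
    rintro l _ ⟨n, rfl⟩
    rw [List.rotate_rotate, add_comm n 1, ← List.rotate_rotate,
      ← List.zipWith_rotate_distrib _ _ _ _ (by simp)]
    exact ((List.rotate_perm _ n).prod_eq).symm)

/-- The product `A_γ` of the scattering amplitudes along a periodic orbit. -/
noncomputable def PeriodicOrbit.coeff (c : G.PeriodicOrbit) (W : G.Coupling) (z : ℂ) : ℂ :=
  cycleProd (W.bondScattering z) c.1

/-- The irreducible pseudo-orbits: the finite collections of periodic orbits that contain no bond
more than once. -/
def IrrPseudoOrbit (G : LeadGraph V E X) : Type _ :=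
  {γ : Multiset G.PeriodicOrbit // (γ.bind PeriodicOrbit.bonds).Nodup}

instance : Finite G.IrrPseudoOrbit := by
  have hP : {c : G.PeriodicOrbit | c.bonds.Nodup}.Finite := by
    have : Finite {c : Cycle G.Bond // c.Nodup} := inferInstance
    refine Set.Finite.of_finite_image (f := Subtype.val)
      (Set.Finite.subset (Set.finite_coe_iff.1 this : {c : Cycle G.Bond | c.Nodup}.Finite) ?_)
      Subtype.val_injective.injOn
    rintro _ ⟨⟨c, hc⟩, h, rfl⟩
    induction c using Quotient.inductionOn with
    | _ l => exact h
  have hS : {γ : Multiset G.PeriodicOrbit | γ ≤ hP.toFinset.val}.Finite :=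
    (Multiset.powerset hP.toFinset.val).finite_toSet.subset fun γ h => by
      simpa using h
  refine (hS.subset ?_ : {γ : Multiset G.PeriodicOrbit |
    (γ.bind PeriodicOrbit.bonds).Nodup}.Finite).to_subtype
  intro γ hγ
  have hγ' := Multiset.nodup_bind.1 hγ
  have hnd : γ.Nodup := by
    rw [Multiset.nodup_iff_ne_cons_cons]
    intro c t h
    obtain rfl := h
    have hd := hγ
    simp only [Set.mem_ofPred_eq, Multiset.cons_bind] at hd
    have hdis := (Multiset.nodup_add.1 hd).2.2
    have hne : ∃ b, b ∈ c.bonds := by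
      obtain ⟨c, hc0, hc⟩ := c
      induction c using Quotient.inductionOn with
      | _ l =>
        cases l with
        | nil => exact absurd rfl hc0
        | cons a l => exact ⟨a, List.mem_cons_self⟩
    obtain ⟨b, hb⟩ := hne
    exact Multiset.disjoint_left.1 hdis hb (Multiset.mem_add.2 (Or.inl hb))
  refine (Multiset.le_iff_subset hnd).2 fun c hc => ?_
  simpa using hγ'.1 c hc

noncomputable instance : Fintype G.IrrPseudoOrbit := Fintype.ofFinite _

/-- The number `m_γ` of periodic orbits in a pseudo-orbit. -/
def IrrPseudoOrbit.count (γ : G.IrrPseudoOrbit) : ℕ := Multiset.card γ.1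

/-- The metric length `ℓ_γ` of a pseudo-orbit. -/
def IrrPseudoOrbit.length (γ : G.IrrPseudoOrbit) (ℓ : E → ℝ) : ℝ :=
  (γ.1.map fun c => c.length ℓ).sum

/-- The coefficient `A_γ(z)` of a pseudo-orbit. -/
noncomputable def IrrPseudoOrbit.coeff (γ : G.IrrPseudoOrbit) (W : G.Coupling) (z : ℂ) : ℂ :=
  (γ.1.map fun c => c.coeff W z).prod

/-- The left-hand side `∑_γ (-1)^{m_γ} A_γ(z) e^{i z ℓ_γ}` of the resonance condition. -/
noncomputable def Coupling.resonanceFunction (W : G.Coupling) (ℓ : E → ℝ) (z : ℂ) : ℂ :=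
  ∑ γ : G.IrrPseudoOrbit,
    (-1) ^ γ.count * γ.coeff W z * Complex.exp (Complex.I * z * (γ.length ℓ : ℂ))

/-! ### Trigonometric sums over irreducible pseudo-orbits

In the following, `a γ` stands for `A_γ`, and `L γ`, `L₁ γ`, `L₂ γ` stand for `ℓ_γ` and its first
and second derivatives. -/

/-- `∑_γ w_γ (-1)^{m_γ} A_γ cos (k ℓ_γ)` -/
noncomputable def cosSum (a L : G.IrrPseudoOrbit → ℝ) (k : ℝ) (w : G.IrrPseudoOrbit → ℝ) : ℝ :=
  ∑ γ, w γ * (-1) ^ γ.count * a γ * Real.cos (k * L γ)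

/-- `∑_γ w_γ (-1)^{m_γ} A_γ sin (k ℓ_γ)` -/
noncomputable def sinSum (a L : G.IrrPseudoOrbit → ℝ) (k : ℝ) (w : G.IrrPseudoOrbit → ℝ) : ℝ :=
  ∑ γ, w γ * (-1) ^ γ.count * a γ * Real.sin (k * L γ)

/-- The first bracket in the formulas for the second derivative; `k₁` is the first derivative
of `k`. -/
noncomputable def bracketOne (a L L₁ L₂ : G.IrrPseudoOrbit → ℝ) (k k₁ : ℝ) : ℝ :=
  2 * k₁ * ∑ γ, (k * L₁ γ * L γ * Real.cos (k * L γ) + L₁ γ * Real.sin (k * L γ)) *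
      a γ * (-1) ^ γ.count
    + k₁ ^ 2 * ∑ γ, L γ ^ 2 * (-1) ^ γ.count * a γ * Real.cos (k * L γ)
    + k * ∑ γ, (k * L₁ γ ^ 2 * Real.cos (k * L γ) + L₂ γ * Real.sin (k * L γ)) *
      (-1) ^ γ.count * a γ

/-- The second bracket in the formulas for the second derivative; `k₁` is the first derivative
of `k`. -/
noncomputable def bracketTwo (a L L₁ L₂ : G.IrrPseudoOrbit → ℝ) (k k₁ : ℝ) : ℝ :=
  2 * k₁ * ∑ γ, (-k * L₁ γ * L γ * Real.sin (k * L γ) + L₁ γ * Real.cos (k * L γ)) *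
      a γ * (-1) ^ γ.count
    - k₁ ^ 2 * ∑ γ, L γ ^ 2 * (-1) ^ γ.count * a γ * Real.sin (k * L γ)
    + k * ∑ γ, (L₂ γ * Real.cos (k * L γ) - k * L₁ γ ^ 2 * Real.sin (k * L γ)) *
      (-1) ^ γ.count * a γ

/-- The common denominator `d`. -/
noncomputable def denom (a L : G.IrrPseudoOrbit → ℝ) (k : ℝ) : ℝ :=
  cosSum a L k L ^ 2 + sinSum a L k L ^ 2

end LeadGraph

/-! The sum over irreducible pseudo-orbits is the secular determinant `det (1 - S D(z))`, with
`D(z)` diagonal with entries `e^{izℓ}` (`sum_eq_det`). Expanding each factor of the Leibniz formula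
yields a sum over pairs (permutation, set `T` of bonds). The nonzero terms are those where the
permutation fixes the bonds outside `T` and moves each bond of `T` to a continuation of it; such
pairs are exactly the pseudo-orbits, and the signs combine to `(-1)^m`.

The determinant form is used twice. An eigenfunction for `k₀²` vanishes on the leads, since plane
waves are not square integrable there, so its amplitudes on the bonds form a nonzero fixed vector of
`S D(k₀)`, and `k₀` solves the resonance condition. Conversely, unitarity of the coupling makes
`S(k₀)` a contraction, so `S(k₀) D(z)` has no fixed vector if `Im z > 0`.

Because the coefficients are constant near `k₀`, the left-hand side is there an exponential sum with
frozen coefficients. As `d ≠ 0`, the implicit function theorem gives a unique `C²` branch `k(t)` of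
zeros. It cannot enter the upper half-plane and is real at `t = 0`, so `Im k` has a local maximum
there and the first derivative is real. Differentiating the identity once and taking one component
gives the first-order formula; differentiating twice gives a real 2×2 linear system of determinant
`d` for the second derivative. -/

namespace Cycle

/-! ### Cycles as orbits of a map -/

variable {B : Type*}

theorem mem_toMultiset_iff {c : Cycle B} {b : B} : b ∈ c.toMultiset ↔ b ∈ c := by
  induction c using Quotient.inductionOn with
  | _ l => exact Multiset.mem_coe

theorem chain_coe_iff_getElem {r : B → B → Prop} {l : List B} :
    Chain r (l : Cycle B) ↔ ∀ (i : ℕ) (h : i < l.length),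
      r l[i] ((l.rotate 1)[i]'(by simpa using h)) := by
  cases l with
  | nil => simp
  | cons a l =>
    rw [chain_coe_cons, List.isChain_iff_getElem]
    have hr : (a :: l).rotate 1 = l ++ [a] := by simp
    have key : ∀ (i : ℕ) (h : i < (a :: l).length) (h' : i < (a :: (l ++ [a])).length),
        (a :: l)[i] = (a :: (l ++ [a]))[i] := by
      intro i h h'
      exact (List.getElem_append_left (bs := [a]) h).symm
    constructor
    · intro H i h
      have := H i (by simpa using h)
      rw [← key i h] at this
      simpa [hr] using this
    · intro H i h
      have h2 : i < (a :: l).length := by simpa using h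
      have := H i h2
      rw [key i h2 (by simp; simp at h; omega)] at this
      simpa [hr] using this

/-- Both relations hold between an entry and the same cyclic successor. With `r` and `s` the graphs
of two maps, this shows that the maps agree on the cycle. -/
theorem exists_of_chain_of_chain {r s : B → B → Prop} {c : Cycle B} (hr : c.Chain r)
    (hs : c.Chain s) {b : B} (hb : b ∈ c) : ∃ b' ∈ c, r b b' ∧ s b b' := by
  induction c using Quotient.inductionOn with
  | _ l =>
    obtain ⟨i, hi, rfl⟩ := List.getElem_of_mem (show b ∈ l from hb)
    refine ⟨(l.rotate 1)[i]'(by simpa using hi), ?_, chain_coe_iff_getElem.1 hr i hi,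
      chain_coe_iff_getElem.1 hs i hi⟩
    exact List.mem_rotate.1 (List.getElem_mem _)

theorem exists_eq_coe_cons_of_mem {c : Cycle B} {b : B} (hb : b ∈ c) :
    ∃ l : List B, c = ((b :: l : List B) : Cycle B) := by
  induction c using Quotient.inductionOn with
  | _ l =>
    obtain ⟨s, t, rfl⟩ := List.append_of_mem (show b ∈ l from hb)
    exact ⟨t ++ s, Cycle.coe_eq_coe.2 (by simpa using List.isRotated_append (l := s) (l' := b :: t))⟩

/-- A cycle without repetitions along which each element is mapped to the next one by `f` is the
periodic orbit of each of its elements. -/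
theorem eq_periodicOrbit_of_chain {c : Cycle B} {f : B → B} (hc : c.Nodup)
    (h : c.Chain fun b b' => f b = b') {b : B} (hb : b ∈ c) :
    c = Function.periodicOrbit f b := by
  obtain ⟨l, rfl⟩ := exists_eq_coe_cons_of_mem hb
  set m := b :: l with hm
  have hpos : 0 < m.length := by simp [hm]
  have H := chain_coe_iff_getElem.1 h
  have hnd : m.Nodup := Cycle.nodup_coe_iff.1 hc
  have hit : ∀ (i : ℕ) (hi : i < m.length), f^[i] b = m[i] := by
    intro i
    induction i with
    | zero => intro _; simp [hm]
    | succ i ih =>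
      intro hi
      rw [Function.iterate_succ_apply', ih (by omega), H i (by omega), List.getElem_rotate]
      congr 1
      exact Nat.mod_eq_of_lt hi
  -- The successor of the last entry has index `(n + 1) % m.length = 0`, which closes the cycle.
  have hper : f^[m.length] b = b := by
    obtain ⟨n, hn⟩ := Nat.exists_eq_succ_of_ne_zero hpos.ne'
    have hn' : n < m.length := by omega
    rw [hn, Function.iterate_succ_apply', hit n hn', H n hn', List.getElem_rotate]
    have h0 : (n + 1) % m.length = 0 := by rw [hn]; exact Nat.mod_self _
    have h0' : m[(n + 1) % m.length]'(Nat.mod_lt _ hpos) = m[0] := by simp only [h0]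
    rw [h0']
    simp [hm]
  have hP : Function.IsPeriodicPt f m.length b := hper
  -- A smaller period would make a later entry equal to entry 0, against `m.Nodup`.
  have hmin : Function.minimalPeriod f b = m.length := by
    refine le_antisymm (hP.minimalPeriod_le hpos) ?_
    by_contra! hlt
    have h0 := hP.minimalPeriod_pos hpos
    have e := hit _ hlt
    rw [Function.iterate_minimalPeriod] at e
    have e0 : m[0] = b := by simp [hm]
    have := (List.Nodup.getElem_inj_iff hnd).1 (e.symm.trans e0.symm)
    omega
  rw [Function.periodicOrbit, hmin]
  congr 1
  refine List.ext_getElem (by simp) fun i hi _ => ?_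
  simp [hit i hi]

end Cycle

/-! ### From disjoint cycles to a permutation and its sign -/

namespace List

variable {B : Type*} [DecidableEq B]

theorem chain_formPerm {l : List B} (hl : l.Nodup) :
    Cycle.Chain (fun b b' => l.formPerm b = b') (l : Cycle B) := by
  refine Cycle.chain_coe_iff_getElem.2 fun i hi => ?_
  rw [formPerm_apply_getElem _ hl, getElem_rotate]

/-- The exponent is `n + 1` instead of `n - 1` to avoid truncated subtraction. A one-element list
gives the identity, which is not a cycle in the sense of `IsCycle`, so it is treated separately. -/
theorem sign_formPerm [Fintype B] {l : List B} (hl : l.Nodup) (h0 : l ≠ []) :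
    Equiv.Perm.sign l.formPerm = (-1) ^ (l.length + 1) := by
  rcases l with - | ⟨a, - | ⟨b, l⟩⟩
  · exact absurd rfl h0
  · simp
  · rw [(isCycle_formPerm hl (by simp)).sign, support_formPerm_of_nodup _ hl (by simp),
      toFinset_card_of_nodup hl, pow_succ, mul_neg_one]

end List

namespace LeadGraph

/-- Once the successor is a function of the bond, the cyclic product no longer depends on the order
and can be merged over several cycles. -/
theorem cycleProd_eq_of_chain {B : Type*} (S : Matrix B B ℂ) {c : Cycle B} {f : B → B}
    (h : c.Chain fun b b' => f b = b') :
    cycleProd S c = (c.toMultiset.map fun b => S (f b) b).prod := by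
  induction c using Quotient.inductionOn with
  | _ l =>
    have H := Cycle.chain_coe_iff_getElem.1 h
    change (List.zipWith (fun b b' => S b' b) l (l.rotate 1)).prod
      = ((l : Multiset B).map fun b => S (f b) b).prod
    rw [Multiset.map_coe, Multiset.prod_coe]
    congr 1
    refine List.ext_getElem (by simp) fun i hi _ => ?_
    have hi' : i < l.length := by simpa using hi
    simp [H i hi']

/-- Disjoint nonempty cycles without repetitions are the orbits of a permutation. -/
theorem exists_perm_of_cycles {B : Type*} [DecidableEq B] [Fintype B] (s : Multiset (Cycle B))
    (h0 : ∀ c ∈ s, c ≠ Cycle.nil) (hs : (s.bind Cycle.toMultiset).Nodup) :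
    ∃ π : Equiv.Perm B, (∀ b, b ∉ s.bind Cycle.toMultiset → π b = b) ∧
      (∀ c ∈ s, c.Chain fun b b' => π b = b') ∧
      Equiv.Perm.sign π = (-1) ^ (Multiset.card (s.bind Cycle.toMultiset) + Multiset.card s) := by
  induction s using Multiset.induction_on with
  | empty => exact ⟨1, by simp⟩
  | cons c s ih =>
    rw [Multiset.cons_bind, Multiset.nodup_add] at hs
    obtain ⟨π, hfix, hch, hsg⟩ := ih (fun c' hc' => h0 c' (Multiset.mem_cons_of_mem hc')) hs.2.1
    have hc0 := h0 c (Multiset.mem_cons_self c s)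
    obtain ⟨hcnd, -, hdis⟩ := hs
    clear ih h0
    induction c using Quotient.inductionOn with
    | _ l =>
      change (l : Multiset B).Nodup at hcnd
      change Disjoint (l : Multiset B) _ at hdis
      change (l : Cycle B) ≠ Cycle.nil at hc0
      have hl : l.Nodup := by simpa using hcnd
      have hl0 : l ≠ [] := fun h => hc0 (by simp [h])
      have hout : ∀ b, b ∈ s.bind Cycle.toMultiset → b ∉ l := fun b hb hbl =>
        Multiset.disjoint_left.1 hdis (by simpa using hbl) hb
      -- By disjointness `π` fixes the entries of `l` and `l.formPerm` fixes the entries of the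
      -- other cycles, so the factors do not interfere.
      refine ⟨l.formPerm * π, ?_, ?_, ?_⟩
      · intro b hb
        change b ∉ (((l : Cycle B) ::ₘ s).bind Cycle.toMultiset) at hb
        rw [Multiset.cons_bind, Multiset.mem_add, not_or] at hb
        rw [Equiv.Perm.mul_apply, hfix b hb.2]
        exact List.formPerm_apply_of_notMem (by simpa using hb.1)
      · intro c' hc'
        rcases Multiset.mem_cons.1 hc' with rfl | hc'
        · change Cycle.Chain _ (l : Cycle B)
          refine Cycle.chain_coe_iff_getElem.2 fun i hi => ?_
          have := Cycle.chain_coe_iff_getElem.1 (List.chain_formPerm hl) i hi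
          rw [Equiv.Perm.mul_apply, hfix, this]
          exact fun hb => hout _ hb (List.getElem_mem _)
        · have hm : ∀ b ∈ c', b ∉ l := fun b hb =>
            hout b (Multiset.mem_bind.2 ⟨c', hc', Cycle.mem_toMultiset_iff.2 hb⟩)
          have h1 := hch c' hc'
          clear hc' hch
          induction c' using Quotient.inductionOn with
          | _ l' =>
            change Cycle.Chain _ (l' : Cycle B)
            refine Cycle.chain_coe_iff_getElem.2 fun i hi => ?_
            have := Cycle.chain_coe_iff_getElem.1 h1 i hi
            rw [Equiv.Perm.mul_apply, this]
            refine List.formPerm_apply_of_notMem (hm _ ?_)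
            exact List.mem_rotate.1 (List.getElem_mem _)
      · rw [map_mul, hsg, List.sign_formPerm hl hl0]
        change _ = (-1) ^ (Multiset.card (((l : Cycle B) ::ₘ s).bind Cycle.toMultiset)
          + Multiset.card ((l : Cycle B) ::ₘ s))
        rw [Multiset.cons_bind, Multiset.card_add, Multiset.card_cons, ← pow_add]
        congr 1
        simp
        ring

end LeadGraph

/-! ### Pseudo-orbits as permutations, and the determinant expansion -/

namespace LeadGraph

variable {V E X : Type*} {G : LeadGraph V E X}

/-- The bonds of a pseudo-orbit. -/
def IrrPseudoOrbit.bonds (γ : G.IrrPseudoOrbit) : Finset G.Bond :=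
  ⟨γ.1.bind PeriodicOrbit.bonds, γ.2⟩

theorem PeriodicOrbit.mem_bonds {c : G.PeriodicOrbit} {b : G.Bond} : b ∈ c.bonds ↔ b ∈ c.1 :=
  Cycle.mem_toMultiset_iff

theorem IrrPseudoOrbit.mem_bonds {γ : G.IrrPseudoOrbit} {b : G.Bond} :
    b ∈ γ.bonds ↔ ∃ c ∈ γ.1, b ∈ c.1 := by
  change b ∈ γ.1.bind PeriodicOrbit.bonds ↔ _
  simp only [Multiset.mem_bind, PeriodicOrbit.mem_bonds]

theorem PeriodicOrbit.exists_mem (c : G.PeriodicOrbit) : ∃ b, b ∈ c.1 := by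
  obtain ⟨c, h0, h⟩ := c
  induction c using Quotient.inductionOn with
  | _ l =>
    cases l with
    | nil => exact absurd rfl h0
    | cons a l => exact ⟨a, List.mem_cons_self⟩

theorem IrrPseudoOrbit.nodup_of_mem (γ : G.IrrPseudoOrbit) {c : G.PeriodicOrbit} (hc : c ∈ γ.1) :
    c.1.Nodup := by
  have := (Multiset.nodup_bind.1 γ.2).1 c hc
  obtain ⟨c, h0, h⟩ := c
  induction c using Quotient.inductionOn with
  | _ l => exact this

theorem IrrPseudoOrbit.nodup (γ : G.IrrPseudoOrbit) : γ.1.Nodup := by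
  rw [Multiset.nodup_iff_ne_cons_cons]
  intro c t h
  have hd := γ.2
  rw [h, Multiset.cons_bind] at hd
  obtain ⟨b, hb⟩ := c.exists_mem
  refine Multiset.disjoint_left.1 (Multiset.nodup_add.1 hd).2.2 (PeriodicOrbit.mem_bonds.2 hb) ?_
  rw [Multiset.cons_bind]
  exact Multiset.mem_add.2 (Or.inl (PeriodicOrbit.mem_bonds.2 hb))

theorem IrrPseudoOrbit.length_eq_sum (γ : G.IrrPseudoOrbit) (ℓ : E → ℝ) :
    γ.length ℓ = ∑ b ∈ γ.bonds, ℓ b.1 := by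
  change _ = ((γ.1.bind PeriodicOrbit.bonds).map fun b => ℓ b.1).sum
  rw [Multiset.map_bind, Multiset.sum_bind]
  rfl

variable [Fintype E] [DecidableEq E]

theorem IrrPseudoOrbit.exists_perm (γ : G.IrrPseudoOrbit) :
    ∃ π : Equiv.Perm G.Bond, (∀ b, b ∉ γ.bonds → π b = b) ∧
      (∀ c ∈ γ.1, c.1.Chain fun b b' => π b = b') ∧
      Equiv.Perm.sign π = (-1) ^ (γ.bonds.card + γ.count) := by
  have e : (γ.1.map Subtype.val).bind Cycle.toMultiset = γ.bonds.val := by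
    exact Multiset.bind_map _ _ _
  obtain ⟨π, h1, h2, h3⟩ := exists_perm_of_cycles (γ.1.map Subtype.val)
    (fun c hc => by
      obtain ⟨c, -, rfl⟩ := Multiset.mem_map.1 hc
      exact c.2.1) (by rw [e]; exact γ.bonds.nodup)
  rw [e] at h1 h3
  refine ⟨π, h1, fun c hc => h2 _ (Multiset.mem_map_of_mem _ hc), ?_⟩
  exact h3.trans (congrArg (fun n => (-1) ^ (γ.bonds.card + n)) (Multiset.card_map _ _))

/-- The permutation of the bonds that moves every bond of a pseudo-orbit to the next one and fixes
the other bonds. -/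
noncomputable def IrrPseudoOrbit.perm (γ : G.IrrPseudoOrbit) : Equiv.Perm G.Bond :=
  γ.exists_perm.choose

theorem IrrPseudoOrbit.perm_apply_of_notMem (γ : G.IrrPseudoOrbit) {b : G.Bond}
    (hb : b ∉ γ.bonds) : γ.perm b = b :=
  γ.exists_perm.choose_spec.1 b hb

theorem IrrPseudoOrbit.chain_perm (γ : G.IrrPseudoOrbit) {c : G.PeriodicOrbit} (hc : c ∈ γ.1) :
    c.1.Chain fun b b' => γ.perm b = b' :=
  γ.exists_perm.choose_spec.2.1 c hc

theorem IrrPseudoOrbit.sign_perm (γ : G.IrrPseudoOrbit) :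
    Equiv.Perm.sign γ.perm = (-1) ^ (γ.bonds.card + γ.count) :=
  γ.exists_perm.choose_spec.2.2

theorem IrrPseudoOrbit.eq_periodicOrbit (γ : G.IrrPseudoOrbit) {c : G.PeriodicOrbit}
    (hc : c ∈ γ.1) {b : G.Bond} (hb : b ∈ c.1) : c.1 = Function.periodicOrbit γ.perm b :=
  Cycle.eq_periodicOrbit_of_chain (γ.nodup_of_mem hc) (γ.chain_perm hc) hb

/-- The periodic orbit through a bond is its orbit under the permutation. The bond set is needed as
well: a bond fixed by the permutation may be an orbit of length one or be absent. -/
theorem IrrPseudoOrbit.ext_perm {γ γ' : G.IrrPseudoOrbit} (hp : γ.perm = γ'.perm)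
    (hb : γ.bonds = γ'.bonds) : γ = γ' := by
  have key : ∀ {γ γ' : G.IrrPseudoOrbit}, γ.perm = γ'.perm → γ.bonds = γ'.bonds →
      ∀ c ∈ γ.1, c ∈ γ'.1 := by
    intro γ γ' hp hb c hc
    obtain ⟨b, hbc⟩ := c.exists_mem
    have hbγ : b ∈ γ.bonds := mem_bonds.2 ⟨c, hc, hbc⟩
    rw [hb] at hbγ
    obtain ⟨c', hc', hbc'⟩ := mem_bonds.1 hbγ
    have : c = c' := Subtype.ext <| by
      rw [γ.eq_periodicOrbit hc hbc, γ'.eq_periodicOrbit hc' hbc', hp]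
    rwa [this]
  exact Subtype.ext <| (Multiset.Nodup.ext γ.nodup γ'.nodup).2 fun c =>
    ⟨key hp hb c, key hp.symm hb.symm c⟩

theorem IrrPseudoOrbit.exists_of_perm (π : Equiv.Perm G.Bond) (T : Finset G.Bond)
    (hfix : ∀ b, b ∉ T → π b = b)
    (hadj : ∀ b ∈ T, G.vertexOf (Bond.head b) = G.vertexOf (π b)) :
    ∃ γ : G.IrrPseudoOrbit, γ.perm = π ∧ γ.bonds = T := by
  classical
  have hper : ∀ b, b ∈ Function.periodicPts π := fun b =>
    Function.mk_mem_periodicPts (orderOf_pos π) (by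
      change π^[orderOf π] b = b
      rw [← Equiv.Perm.coe_pow, pow_orderOf_eq_one]; rfl)
  -- If `π b` were outside `T`, it would be fixed, and injectivity would give `π b = b ∈ T`.
  have hT : ∀ b ∈ T, π b ∈ T := by
    intro b hb
    by_contra h
    have := π.injective (hfix _ h)
    exact h (this.symm ▸ hb)
  have hTi : ∀ b ∈ T, ∀ n : ℕ, π^[n] b ∈ T := by
    intro b hb n
    induction n with
    | zero => exact hb
    | succ n ih => rw [Function.iterate_succ_apply']; exact hT _ ih
  have hchain : ∀ b, (Function.periodicOrbit π b).Chain fun b b' => π b = b' := fun b =>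
    (Function.periodicOrbit_chain' _ (hper b)).2 fun n => (Function.iterate_succ_apply' _ _ _).symm
  let orb : T → G.PeriodicOrbit := fun b => ⟨Function.periodicOrbit π b.1, by
    refine ⟨?_, ?_⟩
    · rw [Ne, Function.periodicOrbit_eq_nil_iff_not_periodic_pt, not_not]
      exact hper _
    · refine (Function.periodicOrbit_chain' _ (hper _)).2 fun n => ?_
      rw [Function.iterate_succ_apply']
      exact hadj _ (hTi _ b.2 n)⟩
  -- Taking a `Finset` image counts each orbit once, although every one of its bonds generates it.
  let s : Finset G.PeriodicOrbit := Finset.univ.image orb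
  have hs : ∀ c : G.PeriodicOrbit, c ∈ s ↔ ∃ b : T, orb b = c := fun c => by simp [s]
  have hmem : ∀ (b : T) (b' : G.Bond), b' ∈ (orb b).1 → ∃ h : b' ∈ T, orb ⟨b', h⟩ = orb b := by
    intro b b' hb'
    obtain ⟨n, rfl⟩ := (Function.mem_periodicOrbit_iff (hper _)).1 hb'
    exact ⟨hTi _ b.2 n, Subtype.ext (Function.periodicOrbit_apply_iterate_eq (hper _) n)⟩
  have hnd : (s.val.bind PeriodicOrbit.bonds).Nodup := by
    refine Multiset.nodup_bind.2 ⟨fun c hc => ?_, ?_⟩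
    · obtain ⟨b, rfl⟩ := (hs c).1 hc
      exact Function.nodup_periodicOrbit
    · refine (s.nodup.pairwise fun c hc c' hc' hne => ?_)
      obtain ⟨b, rfl⟩ := (hs c).1 hc
      obtain ⟨b', rfl⟩ := (hs c').1 hc'
      refine Multiset.disjoint_left.2 fun {x} hx hx' => hne ?_
      obtain ⟨h, e⟩ := hmem b x (PeriodicOrbit.mem_bonds.1 hx)
      obtain ⟨h', e'⟩ := hmem b' x (PeriodicOrbit.mem_bonds.1 hx')
      rw [← e, ← e']
  let γ : G.IrrPseudoOrbit := ⟨s.val, hnd⟩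
  have hbonds : γ.bonds = T := by
    ext b
    rw [IrrPseudoOrbit.mem_bonds]
    constructor
    · rintro ⟨c, hc, hb⟩
      obtain ⟨b', rfl⟩ := (hs c).1 hc
      exact (hmem b' b hb).1
    · intro hb
      exact ⟨orb ⟨b, hb⟩, (hs _).2 ⟨_, rfl⟩, Function.self_mem_periodicOrbit (hper b)⟩
  refine ⟨γ, Equiv.ext fun b => ?_, hbonds⟩
  by_cases hb : b ∈ T
  -- `γ.perm` is only a chosen permutation; it agrees with `π` on `b` because both send `b` to its
  -- successor in the same cycle.
  · have h1 : orb ⟨b, hb⟩ ∈ γ.1 := (hs _).2 ⟨_, rfl⟩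
    obtain ⟨b', -, e1, e2⟩ := Cycle.exists_of_chain_of_chain (γ.chain_perm h1) (hchain b)
      (Function.self_mem_periodicOrbit (hper b))
    rw [e1, e2]
  · rw [γ.perm_apply_of_notMem (hbonds ▸ hb), hfix b hb]

theorem IrrPseudoOrbit.prod_cycleProd (γ : G.IrrPseudoOrbit) (S : Matrix G.Bond G.Bond ℂ) :
    (γ.1.map fun c => cycleProd S c.1).prod = ∏ b ∈ γ.bonds, S (γ.perm b) b := by
  change _ = ((γ.1.bind PeriodicOrbit.bonds).map fun b => S (γ.perm b) b).prod
  rw [Multiset.map_bind, Multiset.prod_bind]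
  congr 1
  exact Multiset.map_congr rfl fun c hc => cycleProd_eq_of_chain S (γ.chain_perm hc)

/-- The expansion of the determinant of `1 - M` into irreducible pseudo-orbits, for a matrix `M`
between bonds that vanishes unless the second bond continues the first one. -/
theorem det_one_sub_eq_sum (M : Matrix G.Bond G.Bond ℂ)
    (hM : ∀ c b, G.vertexOf (Bond.head b) ≠ G.vertexOf c → M c b = 0) :
    (1 - M).det = ∑ γ : G.IrrPseudoOrbit, (-1) ^ γ.count * ∏ b ∈ γ.bonds, M (γ.perm b) b := by
  classical
  -- `T` collects the factors in which `-M` is chosen; the others contribute entries of the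
  -- identity.
  have h1 : (1 - M).det = ∑ p : Equiv.Perm G.Bond × Finset G.Bond,
      ((Equiv.Perm.sign p.1 : ℤ) : ℂ) * ((-1) ^ p.2.card * ∏ b ∈ p.2, M (p.1 b) b) *
        ∏ b ∈ Finset.univ \ p.2, (1 : Matrix G.Bond G.Bond ℂ) (p.1 b) b := by
    rw [Matrix.det_apply', Fintype.sum_prod_type]
    refine Finset.sum_congr rfl fun π _ => ?_
    have : ∏ i, (1 - M) (π i) i = ∏ i, (-M (π i) i + (1 : Matrix G.Bond G.Bond ℂ) (π i) i) :=
      Finset.prod_congr rfl fun i _ => by rw [Matrix.sub_apply]; ring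
    rw [this, Finset.prod_add, Finset.mul_sum, Finset.powerset_univ]
    refine Finset.sum_congr rfl fun T _ => ?_
    dsimp only
    rw [Finset.prod_neg]
    ring
  rw [h1]
  symm
  refine Finset.sum_of_injOn (fun γ : G.IrrPseudoOrbit => (γ.perm, γ.bonds)) ?_ ?_ ?_ ?_
  · intro γ _ γ' _ h
    exact IrrPseudoOrbit.ext_perm (congrArg Prod.fst h) (congrArg Prod.snd h)
  · intro _ _; simp
  · rintro ⟨π, T⟩ - hn
    -- A nonzero term has identity entries off `T`, so `π` is trivial there, and nonzero entries of
    -- `M` on `T`, so `π` follows the graph there.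
    by_contra hne
    rw [← Ne, mul_ne_zero_iff, mul_ne_zero_iff, mul_ne_zero_iff, Finset.prod_ne_zero_iff,
      Finset.prod_ne_zero_iff] at hne
    obtain ⟨⟨-, -, hT⟩, hF⟩ := hne
    obtain ⟨γ, e1, e2⟩ := IrrPseudoOrbit.exists_of_perm π T
      (fun b hb => by
        by_contra h
        exact hF b (by simp [hb]) (Matrix.one_apply_ne h))
      (fun b hb => by
        by_contra h
        exact hT b hb (hM _ _ h))
    exact hn ⟨γ, by simp, by simp [e1, e2]⟩
  · intro γ _
    have h2 : ∏ b ∈ Finset.univ \ γ.bonds, (1 : Matrix G.Bond G.Bond ℂ) (γ.perm b) b = 1 :=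
      Finset.prod_eq_one fun b hb => by
        rw [γ.perm_apply_of_notMem (by simpa using hb), Matrix.one_apply_eq]
    have h3 : ((-1 : ℂ) ^ γ.bonds.card) * (-1) ^ γ.bonds.card = 1 := by
      rw [← mul_pow]; simp
    dsimp only
    rw [h2, γ.sign_perm, mul_one]
    push_cast
    rw [pow_add]
    linear_combination (-(-1) ^ γ.count * ∏ b ∈ γ.bonds, M (γ.perm b) b) * h3

/-- `S` is independent of `z`, so the amplitudes can be frozen at `k₀` while the momentum in the
exponentials varies. -/
theorem sum_eq_det (S : Matrix G.Bond G.Bond ℂ)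
    (hS : ∀ c b, G.vertexOf (Bond.head b) ≠ G.vertexOf c → S c b = 0) (ℓ : E → ℝ) (z : ℂ) :
    ∑ γ : G.IrrPseudoOrbit, (-1) ^ γ.count * (γ.1.map fun c => cycleProd S c.1).prod *
      Complex.exp (Complex.I * z * (γ.length ℓ : ℂ)) =
    (1 - S * Matrix.diagonal fun b : G.Bond => Complex.exp (Complex.I * z * ℓ b.1)).det := by
  rw [det_one_sub_eq_sum]
  · refine Finset.sum_congr rfl fun γ _ => ?_
    rw [γ.prod_cycleProd, γ.length_eq_sum, Complex.ofReal_sum, Finset.mul_sum, Complex.exp_sum,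
      mul_assoc, ← Finset.prod_mul_distrib]
    simp only [Matrix.mul_diagonal]
  · intro c b h
    rw [Matrix.mul_diagonal, hS c b h, zero_mul]

variable [DecidableEq V] [Fintype X] [DecidableEq X]

theorem Coupling.bondScattering_eq_zero (W : G.Coupling) (z : ℂ) {c b : G.Bond}
    (h : G.vertexOf (Bond.head b) ≠ G.vertexOf c) : W.bondScattering z c b = 0 := by
  have : Bond.head (Bond.reverse c) = c := by simp [Bond.head, Bond.reverse]
  exact dif_neg (by rwa [this])

/-- The determinant form of the resonance condition. -/
theorem Coupling.resonanceFunction_eq_det (W : G.Coupling) (ℓ : E → ℝ) (z : ℂ) :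
    W.resonanceFunction ℓ z = (1 - W.bondScattering z *
      Matrix.diagonal fun b : G.Bond => Complex.exp (Complex.I * z * ℓ b.1)).det :=
  sum_eq_det _ (fun _ _ => W.bondScattering_eq_zero z) ℓ z

end LeadGraph

/-! ### Contractivity and absence of zeros in the upper half-plane -/

namespace LeadGraph

variable {V E X : Type*} {G : LeadGraph V E X}

theorem Bond.reverse_reverse (b : G.Bond) : Bond.reverse (Bond.reverse b : G.Bond) = b := by
  simp [Bond.reverse]

variable [DecidableEq V] [Fintype E]

/-- Bonds are grouped by starting vertex. The outer sum runs over the image of `vertexOf` because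
`V` need not be finite. -/
theorem sum_bond_eq_sum_intEnd (f : G.Bond → ℝ) :
    ∑ c, f c = ∑ v ∈ Finset.univ.image G.vertexOf, ∑ p : G.IntEnd v, f p.1 := by
  rw [← Finset.sum_fiberwise_of_maps_to (g := G.vertexOf)
    (fun c _ => Finset.mem_image_of_mem _ (Finset.mem_univ c))]
  refine Finset.sum_congr rfl fun v _ => ?_
  exact Finset.sum_subtype _ (by simp) _

variable [DecidableEq E] [Fintype X] [DecidableEq X]

/-- Scattering is local: the bonds arriving at `v` are the reverses of those starting there. -/
theorem Coupling.bondScattering_mulVec (W : G.Coupling) (z : ℂ) (u : G.Bond → ℂ) {v : V}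
    (p : G.IntEnd v) :
    (W.bondScattering z).mulVec u p.1 =
      (W.effScattering v z).mulVec (fun q => u (Bond.reverse q.1)) p := by
  obtain ⟨c, rfl⟩ := p
  have h1 : ∀ b : G.Bond, W.bondScattering z c b =
      if h : G.vertexOf (Bond.head b) = G.vertexOf c then
        W.effScattering (G.vertexOf c) z ⟨c, rfl⟩ ⟨Bond.head b, h⟩ else 0 := by
    -- `Bond.head (Bond.reverse c)` reduces to `c` definitionally once the Boolean is concrete.
    rcases c with ⟨e, - | -⟩ <;> exact fun b => rfl
  simp only [Matrix.mulVec, dotProduct]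
  symm
  refine Finset.sum_of_injOn (fun q => Bond.reverse q.1) ?_ ?_ ?_ ?_
  · intro q _ q' _ h
    refine Subtype.ext ?_
    rw [← Bond.reverse_reverse (G := G) q.1, ← Bond.reverse_reverse (G := G) q'.1]
    exact congrArg _ h
  · intro _ _; simp
  · intro b _ hb
    rw [h1, dif_neg, zero_mul]
    intro h
    exact hb ⟨⟨Bond.head b, h⟩, by simp, Bond.reverse_reverse b⟩
  · intro q _
    have e : Bond.head (Bond.reverse q.1 : G.Bond) = q.1 := Bond.reverse_reverse (G := G) q.1
    have h2 : G.vertexOf (Bond.head (Bond.reverse q.1 : G.Bond)) = G.vertexOf c := by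
      rw [e]; exact q.2
    rw [h1, dif_pos h2]
    congr 2
    exact Subtype.ext e.symm

theorem Coupling.isEffScattering_effScattering (W : G.Coupling) (v : V) {z : ℂ} (hz : 0 < z.re) :
    W.IsEffScattering v z (W.effScattering v z) :=
  Classical.epsilon_spec (W.exists_isEffScattering v hz)

/-- The unitarity of the coupling in terms of the incoming and outgoing parts of the boundary
values. -/
theorem Coupling.Holds.sum_normSq_eq {W : G.Coupling} {v : V} {Ψ Ψ' : G.VertexEnd v → ℂ}
    (h : W.Holds v Ψ Ψ') :
    ∑ j, Complex.normSq (Ψ j - Complex.I * Ψ' j) = ∑ j, Complex.normSq (Ψ j + Complex.I * Ψ' j) := by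
  set y : G.VertexEnd v → ℂ := Ψ + Complex.I • Ψ' with hy
  have h1 : (W.U v).mulVec y = Ψ - Complex.I • Ψ' := by
    have := h
    rw [Coupling.Holds] at this
    rw [hy, Matrix.mulVec_add, Matrix.mulVec_smul]
    rw [Matrix.sub_mulVec, Matrix.add_mulVec, Matrix.one_mulVec, Matrix.one_mulVec, smul_add] at this
    linear_combination (exp := 1) this
  have hU : star ((W.U v).mulVec y) ⬝ᵥ ((W.U v).mulVec y) = star y ⬝ᵥ y := by
    have := (Matrix.mem_unitaryGroup_iff').1 (W.unitary v)
    rw [Matrix.star_eq_conjTranspose] at this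
    rw [Matrix.star_mulVec, Matrix.dotProduct_mulVec, Matrix.vecMul_vecMul, this, Matrix.vecMul_one]
  have key : ∀ w : G.VertexEnd v → ℂ, star w ⬝ᵥ w = ((∑ j, Complex.normSq (w j) : ℝ) : ℂ) := by
    intro w
    rw [dotProduct, Complex.ofReal_sum]
    refine Finset.sum_congr rfl fun j _ => ?_
    exact (Complex.normSq_eq_conj_mul_self).symm
  rw [h1, key, key] at hU
  exact_mod_cast hU

/-- Flux conservation: the incoming intensity equals the outgoing one on the internal edges plus the
intensity lost to the leads, which is nonnegative. -/
theorem Coupling.IsEffScattering.sum_normSq_le {W : G.Coupling} {v : V} {k : ℝ} (hk : 0 < k)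
    {σ : Matrix (G.IntEnd v) (G.IntEnd v) ℂ} (hσ : W.IsEffScattering v k σ)
    (x : G.IntEnd v → ℂ) :
    ∑ p, Complex.normSq (σ.mulVec x p) ≤ ∑ p, Complex.normSq (x p) := by
  obtain ⟨b, hb⟩ := (hσ x (σ.mulVec x)).2 rfl
  have h := hb.sum_normSq_eq
  simp only [Fintype.sum_sum_type, Sum.elim_inl, Sum.elim_inr] at h
  set y := σ.mulVec x
  have h1 : ∀ p, Complex.normSq (x p + y p - Complex.I * (Complex.I * k * (y p - x p)))
      = Complex.normSq (x p + y p + Complex.I * (Complex.I * k * (y p - x p)))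
        + 4 * k * (Complex.normSq (y p) - Complex.normSq (x p)) := by
    intro p
    simp [Complex.normSq_apply]
    ring
  have h2 : ∀ s, Complex.normSq (b s - Complex.I * (Complex.I * k * b s))
      = Complex.normSq (b s + Complex.I * (Complex.I * k * b s))
        + 4 * k * Complex.normSq (b s) := by
    intro s
    simp [Complex.normSq_apply]
    ring
  simp only [h1, h2, Finset.sum_add_distrib, ← Finset.mul_sum, Finset.sum_sub_distrib] at h
  have h3 : 0 ≤ ∑ s, Complex.normSq (b s) := Finset.sum_nonneg fun s _ => Complex.normSq_nonneg _
  have h4 : 4 * k * ((∑ p, Complex.normSq (y p) - ∑ p, Complex.normSq (x p))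
      + ∑ s, Complex.normSq (b s)) = 0 := by linarith
  have h5 := (mul_eq_zero.1 h4).resolve_left (by positivity)
  linarith

/-- For a real momentum the bond scattering matrix is a contraction. -/
theorem Coupling.sum_normSq_bondScattering_le (W : G.Coupling) {k : ℝ} (hk : 0 < k)
    (u : G.Bond → ℂ) :
    ∑ c, Complex.normSq ((W.bondScattering k).mulVec u c) ≤ ∑ c, Complex.normSq (u c) := by
  have h1 : ∑ c, Complex.normSq (u c) = ∑ c, Complex.normSq (u (Bond.reverse c)) :=
    (Equiv.sum_comp (⟨Bond.reverse, Bond.reverse, Bond.reverse_reverse,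
      Bond.reverse_reverse⟩ : G.Bond ≃ G.Bond) _).symm
  rw [h1, sum_bond_eq_sum_intEnd, sum_bond_eq_sum_intEnd]
  refine Finset.sum_le_sum fun v _ => ?_
  simp only [W.bondScattering_mulVec]
  exact (W.isEffScattering_effScattering v (by simpa using hk)).sum_normSq_le hk _

/-- For `Im z > 0` the diagonal factor strictly decreases the norm of nonzero vectors, and the
scattering matrix at real momentum does not increase it; so the product has no nonzero fixed vector.
-/
theorem Coupling.det_one_sub_ne_zero (W : G.Coupling) {k : ℝ} (hk : 0 < k) {ℓ : E → ℝ}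
    (hℓ : ∀ e, 0 < ℓ e) {z : ℂ} (hz : 0 < z.im) :
    (1 - W.bondScattering k *
      Matrix.diagonal fun b : G.Bond => Complex.exp (Complex.I * z * ℓ b.1)).det ≠ 0 := by
  intro h0
  obtain ⟨u, hu0, hu⟩ := Matrix.exists_mulVec_eq_zero_iff.2 h0
  rw [Matrix.sub_mulVec, Matrix.one_mulVec, sub_eq_zero, ← Matrix.mulVec_mulVec] at hu
  have h1 := W.sum_normSq_bondScattering_le hk
    ((Matrix.diagonal fun b : G.Bond => Complex.exp (Complex.I * z * ℓ b.1)).mulVec u)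
  rw [← hu] at h1
  refine h1.not_gt (Finset.sum_lt_sum ?_ ?_)
  all_goals
    simp only [Matrix.mulVec_diagonal, Complex.normSq_mul]
    have hlt : ∀ b : G.Bond, Complex.normSq (Complex.exp (Complex.I * z * ℓ b.1)) < 1 := by
      intro b
      rw [Complex.normSq_eq_norm_sq, Complex.norm_exp]
      have : (Complex.I * z * ℓ b.1).re < 0 := by
        simp only [Complex.re_mul_ofReal, Complex.I_mul_re]
        nlinarith [hℓ b.1]
      have := (Real.exp_lt_exp.2 this).trans_eq Real.exp_zero
      nlinarith [Real.exp_pos (Complex.I * z * ℓ b.1).re]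
  · intro b _
    exact mul_le_of_le_one_left (Complex.normSq_nonneg _) (hlt b).le
  · obtain ⟨b, hb⟩ := Function.ne_iff.1 hu0
    exact ⟨b, Finset.mem_univ _, mul_lt_of_lt_one_left (Complex.normSq_pos.2 hb) (hlt b)⟩

end LeadGraph

/-! ### Eigenfunctions give solutions of the resonance condition -/

/-- The integral form of the equation `h' = c h`. -/
theorem eq_mul_exp_of_eq_integral {h : ℝ → ℂ} {c : ℂ} {L : ℝ} (hL : 0 ≤ L)
    (hi : IntegrableOn h (Set.Icc 0 L))
    (H : ∀ x ∈ Set.Icc 0 L, h x = h 0 + c * ∫ y in (0 : ℝ)..x, h y) :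
    ∀ x ∈ Set.Icc 0 L, h x = h 0 * Complex.exp (c * x) := by
  have hc : ContinuousOn h (Set.Icc 0 L) := by
    have h1 : ContinuousOn (fun x => ∫ y in (0 : ℝ)..x, h y) (Set.Icc 0 L) := by
      have := intervalIntegral.continuousOn_primitive_interval (f := h) (μ := volume) (a := 0)
        (b := L) (by rwa [Set.uIcc_of_le hL])
      rwa [Set.uIcc_of_le hL] at this
    exact ContinuousOn.congr (continuousOn_const.add (continuousOn_const.mul h1)) H
  -- A continuous extension to all of `ℝ` makes the primitive differentiable at the endpoints too.
  set K : ℝ → ℂ := Set.IccExtend hL ((Set.Icc 0 L).domRestrict h) with hK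
  have hKc : Continuous K := (continuousOn_iff_continuous_domRestrict.1 hc).Icc_extend'
  have hKh : ∀ x ∈ Set.Icc 0 L, K x = h x := fun x hx => by
    rw [hK, Set.IccExtend_of_mem _ _ hx]; rfl
  have hP : ∀ x ∈ Set.Icc 0 L, h x = h 0 + c * ∫ y in (0 : ℝ)..x, K y := by
    intro x hx
    rw [H x hx]
    congr 2
    refine intervalIntegral.integral_congr fun y hy => (hKh y ?_).symm
    rw [Set.uIcc_of_le hx.1] at hy
    exact ⟨hy.1, hy.2.trans hx.2⟩
  set Q : ℝ → ℂ := fun x => Complex.exp (-c * x) * (h 0 + c * ∫ y in (0 : ℝ)..x, K y) with hQ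
  have hd : ∀ x : ℝ, HasDerivAt Q (Complex.exp (-c * x) * (-c * 1) *
      (h 0 + c * ∫ y in (0 : ℝ)..x, K y) + Complex.exp (-c * x) * (c * K x)) x := by
    intro x
    have h1 : HasDerivAt (fun x : ℝ => ∫ y in (0 : ℝ)..x, K y) (K x) x :=
      (hKc.integral_hasStrictDerivAt 0 x).hasDerivAt
    have h2 : HasDerivAt (fun x : ℝ => Complex.exp (-c * x)) (Complex.exp (-c * x) * (-c * 1)) x :=
      ((Complex.ofRealCLM.hasDerivAt (x := x)).const_mul (-c)).cexp
    exact h2.mul ((h1.const_mul c).const_add (h 0))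
  have hconst := constant_of_has_deriv_right_zero (f := Q) (a := 0) (b := L)
    (fun x _ => (hd x).continuousAt.continuousWithinAt) (fun x hx => by
      have hx' : x ∈ Set.Icc 0 L := ⟨hx.1, hx.2.le⟩
      have := hd x
      rw [← hP x hx', hKh x hx'] at this
      convert! this.hasDerivWithinAt using 1
      ring)
  intro x hx
  have h1 := hconst x hx
  rw [hQ] at h1
  simp only [← hP x hx, Complex.ofReal_zero, mul_zero, Complex.exp_zero, one_mul,
    intervalIntegral.integral_same, add_zero] at h1
  rw [← h1, mul_comm, ← mul_assoc, ← Complex.exp_add]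
  simp

namespace LeadGraph

/-- The second-order equation factorises: for `c² = -lam` the function `f' + c f` has derivative `c²
f + c f' = c (f' + c f)`. -/
theorem IsW22On.eq_mul_exp {I : Set ℝ} {f f₁ f₂ : ℝ → ℂ} (hf : IsW22On I f f₁ f₂)
    (hI : MeasurableSet I) {lam c : ℂ} (hc : c ^ 2 = -lam)
    (heq : ∀ᵐ x ∂volume.restrict I, -f₂ x = lam * f x) {L : ℝ} (hL : 0 ≤ L)
    (hLI : Set.Icc 0 L ⊆ I) :
    ∀ x ∈ Set.Icc 0 L, f₁ x + c * f x = (f₁ 0 + c * f 0) * Complex.exp (c * x) := by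
  have hint : ∀ {u : ℝ → ℂ}, MemLp u 2 (volume.restrict I) → IntegrableOn u (Set.Icc 0 L) := by
    intro u hu
    exact (hu.mono_measure (Measure.restrict_mono hLI le_rfl)).integrable (by norm_num)
  have hint' : ∀ {u : ℝ → ℂ}, MemLp u 2 (volume.restrict I) → ∀ x ∈ Set.Icc 0 L,
      IntervalIntegrable u volume 0 x := by
    intro u hu x hx
    rw [intervalIntegrable_iff_integrableOn_Icc_of_le hx.1]
    exact (hint hu).mono_set (Set.Icc_subset_Icc_right hx.2)
  refine eq_mul_exp_of_eq_integral hL ((hint hf.memLp_one).add ((hint hf.memLp_zero).const_mul c)) ?_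
  intro x hx
  rw [hf.eq_integral x (hLI hx), hf.eq_integral_deriv x (hLI hx),
    intervalIntegral.integral_add (hint' hf.memLp_one x hx)
      ((hint' hf.memLp_zero x hx).const_mul c), intervalIntegral.integral_const_mul]
  have h2 : ∫ y in (0 : ℝ)..x, f₂ y = ∫ y in (0 : ℝ)..x, c ^ 2 * f y := by
    refine intervalIntegral.integral_congr_ae ?_
    have := (ae_restrict_iff' hI).1 heq
    filter_upwards [this] with y hy hyx
    rw [Set.uIoc_of_le hx.1] at hyx
    have := hy (hLI ⟨hyx.1.le, hyx.2.trans hx.2⟩)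
    rw [hc]
    linear_combination -this
  rw [h2, intervalIntegral.integral_const_mul]
  ring

/-- There is no nonzero square integrable solution of `-f'' = k² f` on a half-line. -/
theorem IsW22On.eq_zero_of_Ici {f f₁ f₂ : ℝ → ℂ} (hf : IsW22On (Set.Ici 0) f f₁ f₂) {k : ℝ}
    (hk : k ≠ 0) (heq : ∀ᵐ x ∂volume.restrict (Set.Ici (0 : ℝ)), -f₂ x = ((k ^ 2 : ℝ) : ℂ) * f x) :
    (∀ x ∈ Set.Ici (0 : ℝ), f x = 0) ∧ f₁ 0 = 0 := by
  have key : ∀ r : ℝ, r ^ 2 = k ^ 2 → ∀ x ∈ Set.Ici (0 : ℝ),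
      f₁ x + (r * Complex.I) * f x = 0 := by
    intro r hr
    have hc : ((r : ℂ) * Complex.I) ^ 2 = -((k ^ 2 : ℝ) : ℂ) := by
      rw [mul_pow, Complex.I_sq, ← hr]; push_cast; ring
    have h1 : ∀ x ∈ Set.Ici (0 : ℝ), f₁ x + (r * Complex.I) * f x
        = (f₁ 0 + (r * Complex.I) * f 0) * Complex.exp ((r * Complex.I) * x) := fun x hx =>
      hf.eq_mul_exp measurableSet_Ici hc heq (L := x) hx (fun y hy => hy.1) x ⟨hx, le_rfl⟩
    have h2 : MemLp (fun x => f₁ x + (r * Complex.I) * f x) 2 (volume.restrict (Set.Ici 0)) :=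
      hf.memLp_one.add (hf.memLp_zero.const_mul _)
    -- The exponential has modulus one, so a constant is square integrable on a half-line and hence
    -- vanishes.
    have h3 : MemLp (fun _ : ℝ => ‖f₁ 0 + (r * Complex.I) * f 0‖) 2
        (volume.restrict (Set.Ici (0 : ℝ))) := by
      refine h2.norm.ae_eq ?_
      filter_upwards [ae_restrict_mem measurableSet_Ici] with x hx
      have e : (r : ℂ) * Complex.I * x = (r * x : ℝ) * Complex.I := by push_cast; ring
      rw [h1 x hx, norm_mul, e, Complex.norm_exp_ofReal_mul_I, mul_one]
    rw [memLp_const_iff (by norm_num) (by norm_num)] at h3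
    have h4 : f₁ 0 + (r * Complex.I) * f 0 = 0 := by
      rcases h3 with h3 | h3
      · exact norm_eq_zero.1 h3
      · simp at h3
    intro x hx
    rw [h1 x hx, h4, zero_mul]
  have hk' : (k : ℂ) ≠ 0 := by exact_mod_cast hk
  have h1 := key k rfl
  have h2 := key (-k) (by ring)
  refine ⟨fun x hx => ?_, ?_⟩
  · have e : (2 * k * Complex.I) * f x = 0 := by
      have := h2 x hx
      push_cast at this
      linear_combination h1 x hx - this
    exact (mul_eq_zero.1 e).resolve_left (by simp [hk'])
  · have := h2 0 Set.self_mem_Ici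
    push_cast at this
    linear_combination (h1 0 Set.self_mem_Ici + this) / 2

variable {V E X : Type*} [DecidableEq V] [Fintype E] [DecidableEq E] [Fintype X] [DecidableEq X]
variable {G : LeadGraph V E X}

/-- The square root of a positive eigenvalue solves the resonance condition. -/
theorem Coupling.IsEigenvalue.resonanceFunction_eq_zero {W : G.Coupling} {ℓ : E → ℝ} {k : ℝ}
    (hℓ : ∀ e, 0 < ℓ e) (hk : 0 < k) (h : W.IsEigenvalue ℓ (k ^ 2)) :
    W.resonanceFunction ℓ k = 0 := by
  obtain ⟨f, f₁, f₂, g, g₁, g₂, hdom, hf, hg, hne⟩ := h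
  have hk' : (k : ℂ) ≠ 0 := by exact_mod_cast hk.ne'
  have hg0 := fun x => (hdom.external x).eq_zero_of_Ici hk.ne' (hg x)
  set α : E → ℂ := fun e => (f₁ e 0 + k * Complex.I * f e 0) / (2 * k * Complex.I) with hα
  set β : E → ℂ := fun e => (k * Complex.I * f e 0 - f₁ e 0) / (2 * k * Complex.I) with hβ
  have hplus : ∀ e, ∀ x ∈ Set.Icc 0 (ℓ e), f₁ e x + k * Complex.I * f e x
      = 2 * k * Complex.I * α e * Complex.exp (Complex.I * k * x) := by
    intro e x hx
    have := (hdom.internal e).eq_mul_exp measurableSet_Icc (c := k * Complex.I)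
      (by rw [mul_pow, Complex.I_sq]; push_cast; ring) (hf e) (hℓ e).le subset_rfl x hx
    rw [this, mul_comm (k : ℂ) Complex.I, hα]
    field_simp
  have hminus : ∀ e, ∀ x ∈ Set.Icc 0 (ℓ e), f₁ e x - k * Complex.I * f e x
      = -(2 * k * Complex.I * β e * Complex.exp (-(Complex.I * k * x))) := by
    intro e x hx
    have := (hdom.internal e).eq_mul_exp measurableSet_Icc (c := -(k * Complex.I))
      (by rw [neg_sq, mul_pow, Complex.I_sq]; push_cast; ring) (hf e) (hℓ e).le subset_rfl x hx
    rw [neg_mul, ← sub_eq_add_neg] at this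
    rw [this, hβ, neg_mul (k * Complex.I), mul_comm (k : ℂ) Complex.I]
    field_simp
    ring
  have hfx : ∀ e, ∀ x ∈ Set.Icc 0 (ℓ e), f e x = α e * Complex.exp (Complex.I * k * x)
      + β e * Complex.exp (-(Complex.I * k * x)) := by
    intro e x hx
    have h2k : (2 * k * Complex.I : ℂ) ≠ 0 := by simp [hk']
    apply mul_left_cancel₀ h2k
    linear_combination hplus e x hx - hminus e x hx
  have hf₁x : ∀ e, ∀ x ∈ Set.Icc 0 (ℓ e), f₁ e x = Complex.I * k *
      (α e * Complex.exp (Complex.I * k * x) - β e * Complex.exp (-(Complex.I * k * x))) := by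
    intro e x hx
    linear_combination (hplus e x hx + hminus e x hx) / 2
  -- The amplitude of each wave at the start of its bond. The bond `(e, true)` starts at `x = ℓ e`,
  -- hence the factor; `D` transports amplitudes to the arrival end.
  set u : G.Bond → ℂ := fun b =>
    if b.2 then β b.1 * Complex.exp (-(Complex.I * k * ℓ b.1)) else α b.1 with hu
  set D : Matrix G.Bond G.Bond ℂ :=
    Matrix.diagonal fun b : G.Bond => Complex.exp (Complex.I * k * ℓ b.1) with hD
  have hDu : ∀ b, D.mulVec u b = Complex.exp (Complex.I * k * ℓ b.1) * u b := fun b =>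
    Matrix.mulVec_diagonal _ _ _
  have hDf : ∀ e, D.mulVec u (e, false) = Complex.exp (Complex.I * k * ℓ e) * α e := fun e =>
    hDu (e, false)
  have hDt : ∀ e, D.mulVec u (e, true) = β e := fun e => by
    rw [hDu]
    change Complex.exp (Complex.I * k * ℓ e) * (β e * Complex.exp (-(Complex.I * k * ℓ e))) = β e
    rw [mul_left_comm, ← Complex.exp_add, add_neg_cancel, Complex.exp_zero, mul_one]
  have huf : ∀ e, u (e, false) = α e := fun e => rfl
  have hut : ∀ e, u (e, true) = β e * Complex.exp (-(Complex.I * k * ℓ e)) := fun e => rfl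
  have hbv : ∀ v, G.bdryValue ℓ f g v = Sum.elim
      (fun p : G.IntEnd v => D.mulVec u (Bond.reverse p.1) + u p.1) 0 := by
    intro v
    ext (⟨⟨e, - | -⟩, hp⟩ | x)
    · change f e 0 = D.mulVec u (e, true) + u (e, false)
      rw [hDt, huf, hfx e 0 ⟨le_rfl, (hℓ e).le⟩]
      simp [add_comm]
    · change f e (ℓ e) = D.mulVec u (e, false) + u (e, true)
      rw [hDf, hut, hfx e (ℓ e) ⟨(hℓ e).le, le_rfl⟩]
      ring
    · exact (hg0 x.1).1 0 Set.self_mem_Ici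
  have hbd : ∀ v, G.bdryDeriv ℓ f₁ g₁ v = Sum.elim
      (fun p : G.IntEnd v => Complex.I * k * (u p.1 - D.mulVec u (Bond.reverse p.1)))
      (fun s => Complex.I * k * (0 : G.ExtEnd v → ℂ) s) := by
    intro v
    ext (⟨⟨e, - | -⟩, hp⟩ | x)
    · change f₁ e 0 = Complex.I * k * (u (e, false) - D.mulVec u (e, true))
      rw [hDt, huf, hf₁x e 0 ⟨le_rfl, (hℓ e).le⟩]
      simp
    · change -f₁ e (ℓ e) = Complex.I * k * (u (e, true) - D.mulVec u (e, false))
      rw [hDf, hut, hf₁x e (ℓ e) ⟨(hℓ e).le, le_rfl⟩]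
      ring
    · simpa [bdryDeriv] using (hg0 x.1).2
  have hsol : ∀ c, (W.bondScattering k).mulVec (D.mulVec u) c = u c := by
    intro c
    have h1 := hdom.coupling (G.vertexOf c)
    rw [hbv, hbd] at h1
    have h2 := ((W.isEffScattering_effScattering (G.vertexOf c) (z := k) (by simpa using hk))
      (fun p => D.mulVec u (Bond.reverse p.1)) (fun p => u p.1)).1 ⟨0, h1⟩
    rw [W.bondScattering_mulVec (k : ℂ) (D.mulVec u) (⟨c, rfl⟩ : G.IntEnd (G.vertexOf c)), ← h2]
  have hu0 : u ≠ 0 := by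
    intro h0
    have hα0 : ∀ e, α e = 0 := fun e => by simpa [hu] using congrFun h0 (e, false)
    have hβ0 : ∀ e, β e = 0 := fun e => by
      simpa [hu, Complex.exp_ne_zero] using congrFun h0 (e, true)
    refine hne ⟨fun e => ?_, fun j => ?_⟩
    · filter_upwards [ae_restrict_mem measurableSet_Icc] with x hx
      rw [hfx e x hx, hα0, hβ0]
      simp
    · filter_upwards [ae_restrict_mem measurableSet_Ici] with x hx
      exact (hg0 j).1 x hx
  rw [W.resonanceFunction_eq_det]
  refine Matrix.exists_mulVec_eq_zero_iff.1 ⟨u, hu0, ?_⟩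
  rw [Matrix.sub_mulVec, Matrix.one_mulVec, ← Matrix.mulVec_mulVec, sub_eq_zero]
  exact (funext hsol).symm

end LeadGraph

/-! ### Branches of zeros of exponential sums -/

theorem ContDiffAt.eventually_hasDerivAt_two {F : Type*} [NormedAddCommGroup F] [NormedSpace ℝ F]
    {g : ℝ → F} {x : ℝ} (hg : ContDiffAt ℝ 2 g x) :
    (∀ᶠ t in 𝓝 x, HasDerivAt g (deriv g t) t) ∧
      HasDerivAt (deriv g) (iteratedDeriv 2 g x) x := by
  constructor
  · filter_upwards [hg.eventually (by simp)] with t ht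
    exact (ht.differentiableAt (by simp)).hasDerivAt
  · have h1 : ContDiffAt ℝ 1 (deriv g) x :=
      (hg.fderiv_right (m := 1) (by norm_num)).clm_apply contDiffAt_const
    have := (h1.differentiableAt (by simp)).hasDerivAt
    rwa [iteratedDeriv_succ, iteratedDeriv_one]

section ExponentialSum

variable {ι : Type*} [Fintype ι] {c : ι → ℂ} {l : ι → ℝ → ℝ}

/-- The implicit function theorem for the zeros of an exponential sum. -/
theorem exists_implicit_expSum (hl : ∀ i, ContDiffAt ℝ 2 (l i) 0) {k₀ : ℂ}
    (h0 : ∑ i, c i * Complex.exp (Complex.I * k₀ * l i 0) = 0)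
    (h1 : ∑ i, c i * l i 0 * Complex.exp (Complex.I * k₀ * l i 0) ≠ 0) :
    ∃ φ : ℝ → ℂ, φ 0 = k₀ ∧ ContDiffAt ℝ 2 φ 0 ∧ ∀ᶠ p in 𝓝 ((0 : ℝ), k₀),
      ∑ i, c i * Complex.exp (Complex.I * p.2 * l i p.1) = 0 ↔ p.2 = φ p.1 := by
  set F : ℝ × ℂ → ℂ := fun p => ∑ i, c i * Complex.exp (Complex.I * p.2 * l i p.1) with hF
  have hFc : ContDiffAt ℝ 2 F ((0 : ℝ), k₀) := by
    refine ContDiffAt.sum fun i _ => contDiffAt_const.mul (ContDiffAt.cexp ?_)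
    refine (contDiffAt_const.mul contDiffAt_snd).mul ?_
    exact Complex.ofRealCLM.contDiff.contDiffAt.comp _
      ((hl i).comp ((0 : ℝ), k₀) contDiffAt_fst)
  set w : ℂ := ∑ i, c i * (Complex.exp (Complex.I * k₀ * l i 0) * (Complex.I * 1 * l i 0)) with hw
  have hw0 : w ≠ 0 := by
    have : w = Complex.I * ∑ i, c i * l i 0 * Complex.exp (Complex.I * k₀ * l i 0) := by
      rw [hw, Finset.mul_sum]
      exact Finset.sum_congr rfl fun i _ => by ring
    rw [this]
    exact mul_ne_zero Complex.I_ne_zero h1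
  have hd : HasDerivAt (fun z : ℂ => F (0, z)) w k₀ := by
    refine HasDerivAt.fun_sum fun i _ => ?_
    exact ((((hasDerivAt_id k₀).const_mul Complex.I).mul_const (l i 0 : ℂ)).cexp).const_mul (c i)
  -- The parameter `t` is real, so the calculus is over `ℝ`; the partial derivative in `z` is
  -- multiplication by the nonzero complex number `w`.
  have hinv : (fderiv ℝ F ((0 : ℝ), k₀) ∘L .inr ℝ ℝ ℂ).IsInvertible := by
    have e1 : HasFDerivAt (fun z : ℂ => F (0, z)) (fderiv ℝ F ((0 : ℝ), k₀) ∘L .inr ℝ ℝ ℂ) k₀ :=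
      (hFc.differentiableAt (by simp)).hasFDerivAt.comp k₀ (hasFDerivAt_prodMk_right (0 : ℝ) k₀)
    refine ⟨((ContinuousLinearEquiv.unitsEquivAut ℂ (Units.mk0 w hw0)).restrictScalars ℝ), ?_⟩
    have e2 := hd.hasFDerivAt.restrictScalars ℝ
    rw [e1.unique e2]
    ext
    simp
  refine ⟨hFc.implicitFunction (by simp) hinv, hFc.implicitFunction_apply_self _ _,
    hFc.contDiffAt_implicitFunction _ _, ?_⟩
  filter_upwards [hFc.eventually_apply_eq_iff_implicitFunction (by simp) hinv] with p hp
  have : F ((0 : ℝ), k₀) = 0 := h0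
  rw [this] at hp
  exact hp.trans eq_comm

variable {φ : ℝ → ℂ}

/-- The first two derivatives of the identity that defines a branch of zeros of an exponential
sum. -/
theorem expSum_deriv_identities (hl : ∀ i, ContDiffAt ℝ 2 (l i) 0) (hφ : ContDiffAt ℝ 2 φ 0)
    (h : ∀ᶠ t in 𝓝 (0 : ℝ), ∑ i, c i * Complex.exp (Complex.I * φ t * l i t) = 0) :
    ∑ i, c i * (Complex.exp (Complex.I * φ 0 * l i 0) *
      (Complex.I * (deriv φ 0 * l i 0 + φ 0 * deriv (l i) 0))) = 0 ∧
    ∑ i, c i * (Complex.exp (Complex.I * φ 0 * l i 0) *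
      ((Complex.I * (deriv φ 0 * l i 0 + φ 0 * deriv (l i) 0)) ^ 2 +
        Complex.I * (iteratedDeriv 2 φ 0 * l i 0 + 2 * deriv φ 0 * deriv (l i) 0
          + φ 0 * iteratedDeriv 2 (l i) 0))) = 0 := by
  obtain ⟨hφ1, hφ2⟩ := hφ.eventually_hasDerivAt_two
  have hθ : ∀ i t, HasDerivAt φ (deriv φ t) t → HasDerivAt (l i) (deriv (l i) t) t →
      HasDerivAt (fun t => Complex.exp (Complex.I * φ t * l i t))
        (Complex.exp (Complex.I * φ t * l i t) *
          (Complex.I * (deriv φ t * l i t + φ t * deriv (l i) t))) t := by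
    intro i t h1 h2
    convert! ((h1.const_mul Complex.I).mul h2.ofReal_comp).cexp using 1
    simp only [Pi.mul_apply]
    ring
  have hl1 : ∀ᶠ t in 𝓝 (0 : ℝ), ∀ i, HasDerivAt (l i) (deriv (l i) t) t :=
    eventually_all.2 fun i => (hl i).eventually_hasDerivAt_two.1
  have hfirst : ∀ᶠ t in 𝓝 (0 : ℝ), ∑ i, c i * (Complex.exp (Complex.I * φ t * l i t) *
      (Complex.I * (deriv φ t * l i t + φ t * deriv (l i) t))) = 0 := by
    filter_upwards [hφ1, hl1, h.eventually_nhds] with t h1 h2 h3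
    have e1 := HasDerivAt.fun_sum fun i (_ : i ∈ Finset.univ) => (hθ i t h1 (h2 i)).const_mul (c i)
    exact e1.unique ((hasDerivAt_const t (0 : ℂ)).congr_of_eventuallyEq h3)
  refine ⟨hfirst.self_of_nhds, ?_⟩
  have hlin : ∀ i, HasDerivAt (fun t => Complex.I * (deriv φ t * l i t + φ t * deriv (l i) t))
      (Complex.I * (iteratedDeriv 2 φ 0 * l i 0 + 2 * deriv φ 0 * deriv (l i) 0
          + φ 0 * iteratedDeriv 2 (l i) 0)) 0 := by
    intro i
    have a1 := hφ1.self_of_nhds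
    have a2 := (hl1.self_of_nhds i).ofReal_comp
    have a3 := ((hl i).eventually_hasDerivAt_two.2).ofReal_comp
    convert! ((hφ2.mul a2).add (a1.mul a3)).const_mul Complex.I using 1
    ring
  have e1 := HasDerivAt.fun_sum fun i (_ : i ∈ Finset.univ) =>
    ((hθ i 0 hφ1.self_of_nhds (hl1.self_of_nhds i)).mul (hlin i)).const_mul (c i)
  have e2 := e1.unique ((hasDerivAt_const (0 : ℝ) (0 : ℂ)).congr_of_eventuallyEq hfirst)
  rw [← e2]
  exact Finset.sum_congr rfl fun i _ => by ring

end ExponentialSum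

/-- A curve that stays in the closed lower half-plane and touches the real axis has a real
derivative there. -/
theorem deriv_im_eq_zero_of_im_nonpos {φ : ℝ → ℂ} {x : ℝ} (hφ : DifferentiableAt ℝ φ x)
    (h0 : (φ x).im = 0) (h : ∀ᶠ t in 𝓝 x, (φ t).im ≤ 0) : (deriv φ x).im = 0 := by
  have h1 : HasDerivAt (fun t => (φ t).im) (deriv φ x).im x :=
    Complex.imCLM.hasFDerivAt.comp_hasDerivAt x hφ.hasDerivAt
  refine IsLocalMax.hasDerivAt_eq_zero ?_ h1
  filter_upwards [h] with t ht
  simpa [h0] using ht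

/-! ### Standard coupling -/

namespace LeadGraph

theorem cycleProd_mem {B : Type*} {S : Matrix B B ℂ} {R : Submonoid ℂ} (hS : ∀ c b, S c b ∈ R)
    (c : Cycle B) : cycleProd S c ∈ R := by
  induction c using Quotient.inductionOn with
  | _ l =>
    refine R.list_prod_mem fun x hx => ?_
    obtain ⟨i, hi, rfl⟩ := List.getElem_of_mem hx
    rw [List.getElem_zipWith]
    exact hS _ _

variable {V E X : Type*} [DecidableEq V] [Fintype E] [DecidableEq E] [Fintype X] [DecidableEq X]
variable {G : LeadGraph V E X}

/-- The standard coupling: the values agree and the outgoing derivatives add up to zero. -/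
theorem Coupling.IsStandard.holds_iff {W : G.Coupling} (hW : W.IsStandard) {v : V}
    (hd : (Fintype.card (G.VertexEnd v) : ℂ) ≠ 0) (Ψ Ψ' : G.VertexEnd v → ℂ) :
    W.Holds v Ψ Ψ' ↔
      (∀ j, Fintype.card (G.VertexEnd v) * Ψ j = ∑ i, Ψ i) ∧ ∑ i, Ψ' i = 0 := by
  set d : ℂ := (Fintype.card (G.VertexEnd v) : ℂ) with hdd
  have hJ : ∀ w : G.VertexEnd v → ℂ, ((2 / d) • Matrix.of
      (fun _ _ : G.VertexEnd v => (1 : ℂ))).mulVec w = fun _ => 2 / d * ∑ i, w i := by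
    intro w
    ext j
    simp [Matrix.mulVec, dotProduct, Matrix.smul_apply, Finset.mul_sum, -Fintype.sum_sum_type]
  have h1 : W.Holds v Ψ Ψ' ↔
      ∀ j, 2 / d * ∑ i, Ψ i - 2 * Ψ j + Complex.I * (2 / d * ∑ i, Ψ' i) = 0 := by
    rw [Coupling.Holds, hW v, funext_iff]
    refine forall_congr' fun j => ?_
    rw [sub_add_cancel, Matrix.sub_mulVec, Matrix.sub_mulVec, Matrix.one_mulVec, hJ, hJ]
    simp only [Pi.add_apply, Pi.sub_apply, Pi.smul_apply, smul_eq_mul, Pi.zero_apply]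
    rw [sub_sub, ← two_mul]
  rw [h1]
  constructor
  · intro h
    -- Summing the rows cancels the boundary values and isolates the sum of the derivatives.
    have hs := Finset.sum_eq_zero fun j (_ : j ∈ Finset.univ) => h j
    rw [Finset.sum_add_distrib, Finset.sum_sub_distrib, ← Finset.mul_sum _ Ψ, Finset.sum_const,
      Finset.sum_const, Finset.card_univ, nsmul_eq_mul, nsmul_eq_mul, ← hdd] at hs
    have h0 : ∑ i, Ψ' i = 0 := by
      have : 2 * Complex.I * ∑ i, Ψ' i = 0 := by
        rw [← hs]; field_simp; ring
      exact (mul_eq_zero.1 this).resolve_left (by simp)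
    refine ⟨fun j => ?_, h0⟩
    have := h j
    rw [h0] at this
    field_simp at this
    linear_combination -this / 2
  · rintro ⟨h, h0⟩ j
    rw [h0, ← h j]
    field_simp
    ring

/-- The derivative condition gives `∑ aout + ∑ b = ∑ ain`, so the common vertex value is `(2 / d) ∑
ain`; this is also the amplitude on every lead. Only `z ≠ 0` is needed. -/
theorem Coupling.IsStandard.isEffScattering {W : G.Coupling} (hW : W.IsStandard) {v : V}
    (hd : (Fintype.card (G.VertexEnd v) : ℂ) ≠ 0) {z : ℂ} (hz : z ≠ 0) :
    W.IsEffScattering v z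
      ((2 / (Fintype.card (G.VertexEnd v) : ℂ)) • Matrix.of (fun _ _ => (1 : ℂ)) - 1) := by
  have hcard : (Fintype.card (G.VertexEnd v) : ℂ) =
      Fintype.card (G.IntEnd v) + Fintype.card (G.ExtEnd v) := by
    rw [Fintype.card_sum]; push_cast; rfl
  intro ain aout
  simp only [hW.holds_iff hd]
  set d : ℂ := (Fintype.card (G.VertexEnd v) : ℂ) with hdd
  have hJ : ((2 / d) • Matrix.of (fun _ _ : G.IntEnd v => (1 : ℂ)) - 1).mulVec ain
      = fun p => 2 / d * ∑ i, ain i - ain p := by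
    ext j
    rw [Matrix.sub_mulVec, Matrix.one_mulVec]
    simp [Matrix.mulVec, dotProduct, Finset.mul_sum]
  rw [hJ]
  simp only [Fintype.sum_sum_type, Sum.forall, Sum.elim_inl, Sum.elim_inr, Finset.sum_add_distrib,
    ← Finset.mul_sum, Finset.sum_sub_distrib]
  constructor
  · rintro ⟨b, ⟨h1, -⟩, h3⟩
    have h4 : ∑ p, aout p - ∑ p, ain p + ∑ s, b s = 0 := by
      have : Complex.I * z * (∑ p, aout p - ∑ p, ain p + ∑ s, b s) = 0 := by
        linear_combination h3
      exact (mul_eq_zero.1 this).resolve_left (mul_ne_zero Complex.I_ne_zero hz)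
    ext p
    have := h1 p
    field_simp
    linear_combination this + h4
  · intro h
    have hs : ∑ p, aout p = Fintype.card (G.IntEnd v) * (2 / d * ∑ i, ain i) - ∑ i, ain i := by
      rw [h, Finset.sum_sub_distrib, Finset.sum_const, nsmul_eq_mul, Finset.card_univ]
    refine ⟨fun _ => 2 / d * ∑ i, ain i, ⟨fun p => ?_, fun s => ?_⟩, ?_⟩
    all_goals
      rw [hs, Finset.sum_const, nsmul_eq_mul, Finset.card_univ]
      try rw [h]
      rw [hcard] at hd ⊢
      field_simp
      ring

/-- For the standard coupling the bond scattering matrix is real and does not depend on the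
momentum. -/
theorem Coupling.IsStandard.bondScattering_eq {W : G.Coupling} (hW : W.IsStandard) (c b : G.Bond) :
    ∃ r : ℝ, ∀ z : ℂ, z ≠ 0 → W.bondScattering z c b = r := by
  by_cases h : G.vertexOf (Bond.head b) = G.vertexOf (Bond.head (Bond.reverse c : G.Bond))
  · have hd : (Fintype.card (G.VertexEnd (G.vertexOf (Bond.head (Bond.reverse c : G.Bond)))) : ℂ)
        ≠ 0 := by
      have : Nonempty (G.VertexEnd (G.vertexOf (Bond.head (Bond.reverse c : G.Bond)))) :=
        ⟨Sum.inl ⟨Bond.head b, h⟩⟩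
      exact_mod_cast Fintype.card_ne_zero
    refine ⟨2 / (Fintype.card (G.VertexEnd (G.vertexOf (Bond.head (Bond.reverse c : G.Bond)))))
      - (1 : Matrix (G.IntEnd _) (G.IntEnd _) ℝ)
        ⟨Bond.head (Bond.reverse c : G.Bond), rfl⟩ ⟨Bond.head b, h⟩, fun z hz => ?_⟩
    have h1 := hW.isEffScattering hd hz
    -- `h1` supplies existence for the `epsilon` choice even outside the right half-plane;
    -- uniqueness then identifies it.
    have h2 : W.effScattering _ z = _ :=
      Coupling.IsEffScattering.unique (Classical.epsilon_spec ⟨_, h1⟩) h1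
    rw [Coupling.bondScattering, Coupling.sigmaMatrix, dif_pos h, h2]
    simp [Matrix.one_apply, apply_ite Complex.ofReal]
  · exact ⟨0, fun z _ => by
      rw [Coupling.bondScattering, Coupling.sigmaMatrix, dif_neg h, Complex.ofReal_zero]⟩

theorem Coupling.IsStandard.coeff_eq {W : G.Coupling} (hW : W.IsStandard) (γ : G.IrrPseudoOrbit) :
    ∃ a : ℝ, ∀ z : ℂ, z ≠ 0 → γ.coeff W z = a := by
  choose r hr using hW.bondScattering_eq
  have h1 : ∀ z : ℂ, z ≠ 0 → W.bondScattering z = fun c b => (r c b : ℂ) := fun z hz => by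
    ext c b; exact hr c b z hz
  have h2 : (γ.1.map fun c => cycleProd (fun c b => (r c b : ℂ)) c.1).prod ∈
      MonoidHom.mrange (Complex.ofRealHom : ℝ →* ℂ) := by
    refine Submonoid.multiset_prod_mem _ _ fun x hx => ?_
    obtain ⟨c, -, rfl⟩ := Multiset.mem_map.1 hx
    exact cycleProd_mem (R := MonoidHom.mrange (Complex.ofRealHom : ℝ →* ℂ)) (fun c b => ⟨r c b, rfl⟩) _
  obtain ⟨a, ha⟩ := h2
  refine ⟨a, fun z hz => ?_⟩
  rw [IrrPseudoOrbit.coeff]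
  simp only [PeriodicOrbit.coeff, h1 z hz]
  exact ha.symm

end LeadGraph

/-! ### Real and imaginary parts of the differentiated condition -/

namespace LeadGraph

variable {V E X : Type*} {G : LeadGraph V E X}

theorem IrrPseudoOrbit.contDiffAt_length (γ : G.IrrPseudoOrbit) {ℓ : E → ℝ → ℝ} {n : WithTop ℕ∞}
    {x : ℝ} (hℓ : ∀ e, ContDiffAt ℝ n (ℓ e) x) :
    ContDiffAt ℝ n (fun t => γ.length fun e => ℓ e t) x := by
  simp only [γ.length_eq_sum]
  exact ContDiffAt.sum fun b _ => hℓ b.1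

variable [Fintype E] [DecidableEq E]

/-- The value of a trigonometric sum over pseudo-orbits with complex exponentials. -/
theorem sum_mul_exp_eq (a L w : G.IrrPseudoOrbit → ℝ) (k : ℝ) :
    ∑ γ, ((-1) ^ γ.count * a γ : ℂ) * w γ * Complex.exp (Complex.I * k * L γ) =
      cosSum a L k w + sinSum a L k w * Complex.I := by
  rw [cosSum, sinSum, Complex.ofReal_sum, Complex.ofReal_sum, Finset.sum_mul,
    ← Finset.sum_add_distrib]
  refine Finset.sum_congr rfl fun γ _ => ?_
  have : Complex.I * k * L γ = ((k * L γ : ℝ) : ℂ) * Complex.I := by push_cast; ring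
  rw [this, Complex.exp_mul_I, ← Complex.ofReal_cos, ← Complex.ofReal_sin]
  push_cast
  ring

/-- The second derivative of a branch of zeros, from the equation it satisfies. -/
theorem im_re_of_second_order_eq {a L L₁ L₂ : G.IrrPseudoOrbit → ℝ} {k k₁ : ℝ} {k₂ : ℂ}
    (hd : denom a L k ≠ 0)
    (h : ∑ γ, ((-1) ^ γ.count * a γ : ℂ) * (Complex.exp (Complex.I * k * L γ) *
      ((Complex.I * (k₁ * L γ + k * L₁ γ)) ^ 2 +
        Complex.I * (k₂ * L γ + 2 * k₁ * L₁ γ + k * L₂ γ))) = 0) :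
    k₂.im = -(cosSum a L k L / denom a L k) * bracketOne a L L₁ L₂ k k₁
        + sinSum a L k L / denom a L k * bracketTwo a L L₁ L₂ k k₁ ∧
    k₂.re = -(sinSum a L k L / denom a L k) * bracketOne a L L₁ L₂ k k₁
        - cosSum a L k L / denom a L k * bracketTwo a L L₁ L₂ k k₁ := by
  have hterm : ∀ γ : G.IrrPseudoOrbit, ((-1) ^ γ.count * a γ : ℂ) *
      (Complex.exp (Complex.I * k * L γ) * ((Complex.I * (k₁ * L γ + k * L₁ γ)) ^ 2 +
        Complex.I * (k₂ * L γ + 2 * k₁ * L₁ γ + k * L₂ γ))) =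
      (((-1) ^ γ.count * a γ * (Real.cos (k * L γ) * (-(k₁ * L γ + k * L₁ γ) ^ 2 - k₂.im * L γ)
        - Real.sin (k * L γ) * (k₂.re * L γ + 2 * k₁ * L₁ γ + k * L₂ γ)) : ℝ) : ℂ) +
      (((-1) ^ γ.count * a γ * (Real.cos (k * L γ) * (k₂.re * L γ + 2 * k₁ * L₁ γ + k * L₂ γ)
        + Real.sin (k * L γ) * (-(k₁ * L γ + k * L₁ γ) ^ 2 - k₂.im * L γ)) : ℝ) : ℂ) *
        Complex.I := by
    intro γ
    have : Complex.I * k * L γ = ((k * L γ : ℝ) : ℂ) * Complex.I := by push_cast; ring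
    rw [this, Complex.exp_mul_I, ← Complex.ofReal_cos, ← Complex.ofReal_sin]
    conv_lhs => rw [← Complex.re_add_im k₂]
    push_cast
    ring_nf
    simp only [Complex.I_sq, Complex.I_pow_three]
    ring
  simp only [hterm, Finset.sum_add_distrib, ← Finset.sum_mul, ← Complex.ofReal_sum] at h
  have hre := congrArg Complex.re h
  have him := congrArg Complex.im h
  simp only [Complex.add_re, Complex.add_im, Complex.ofReal_re, Complex.ofReal_im, Complex.mul_re,
    Complex.mul_im, Complex.I_re, Complex.I_im, Complex.zero_re, Complex.zero_im, mul_zero, mul_one,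
    sub_zero, add_zero, zero_add] at hre him
  -- `e1` is minus the real part and `e2` the imaginary part: a linear system for `(k₂.im, k₂.re)`
  -- with rows `(C, S)` and `(-S, C)`, of determinant `d`.
  have e1 : bracketOne a L L₁ L₂ k k₁ + k₂.im * cosSum a L k L + k₂.re * sinSum a L k L = 0 := by
    rw [← neg_eq_zero, ← hre, bracketOne, cosSum, sinSum]
    simp only [Finset.mul_sum, ← Finset.sum_add_distrib, ← Finset.sum_neg_distrib]
    exact Finset.sum_congr rfl fun γ _ => by ring
  have e2 : bracketTwo a L L₁ L₂ k k₁ + k₂.re * cosSum a L k L - k₂.im * sinSum a L k L = 0 := by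
    rw [← him, bracketTwo, cosSum, sinSum]
    simp only [Finset.mul_sum, ← Finset.sum_add_distrib, ← Finset.sum_sub_distrib]
    exact Finset.sum_congr rfl fun γ _ => by ring
  have hdef : denom a L k = cosSum a L k L ^ 2 + sinSum a L k L ^ 2 := rfl
  generalize denom a L k = d at *
  generalize cosSum a L k L = C at *
  generalize sinSum a L k L = S at *
  generalize bracketOne a L L₁ L₂ k k₁ = B₁ at *
  generalize bracketTwo a L L₁ L₂ k k₁ = B₂ at *
  constructor
  · field_simp
    linear_combination k₂.im * hdef + C * e1 - S * e2
  · field_simp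
    linear_combination k₂.re * hdef + S * e1 + C * e2

end LeadGraph

/-! ### The theorem -/

theorem mainTheorem2 {V E X : Type*} [DecidableEq V] [Fintype E] [DecidableEq E] [Fintype X]
    [DecidableEq X] (G : LeadGraph V E X) (W : G.Coupling) :
    (∀ (ℓ : E → ℝ → ℝ) (k₀ : ℝ) (a L L₁ L₂ : G.IrrPseudoOrbit → ℝ),
      (∀ e, ContDiffAt ℝ 2 (ℓ e) 0) → (∀ e, 0 < ℓ e 0) →
      0 < k₀ → W.IsEigenvalue (fun e => ℓ e 0) (k₀ ^ 2) →
      -- the coefficients are real and independent of the momentum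
      (∀ γ : G.IrrPseudoOrbit, ∀ᶠ z in 𝓝 (k₀ : ℂ), γ.coeff W z = (a γ : ℂ)) →
      -- `L`, `L₁`, `L₂` are the lengths and their derivatives at `t = 0`
      (∀ γ, L γ = γ.length (fun e => ℓ e 0)) →
      (∀ γ, L₁ γ = deriv (fun t => γ.length (fun e => ℓ e t)) 0) →
      (∀ γ, L₂ γ = iteratedDeriv 2 (fun t => γ.length (fun e => ℓ e t)) 0) →
      LeadGraph.denom a L k₀ ≠ 0 →
      ∃ (k : ℝ → ℂ) (ε δ k₁ : ℝ), 0 < ε ∧ 0 < δ ∧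
        k 0 = (k₀ : ℂ) ∧ ContDiffAt ℝ 2 k 0 ∧
        -- `k t` is the unique solution of the resonance condition near `k₀`
        (∀ t : ℝ, |t| < ε → k t ∈ Metric.ball (k₀ : ℂ) δ ∧
          ∀ z ∈ Metric.ball (k₀ : ℂ) δ,
            W.resonanceFunction (fun e => ℓ e t) z = 0 ↔ z = k t) ∧
        deriv k 0 = (k₁ : ℂ) ∧
        k₁ * LeadGraph.cosSum a L k₀ L = -k₀ * LeadGraph.cosSum a L k₀ L₁ ∧
        (LeadGraph.cosSum a L k₀ L ≠ 0 →
          k₁ = -k₀ * (LeadGraph.cosSum a L k₀ L₁ / LeadGraph.cosSum a L k₀ L)) ∧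
        (iteratedDeriv 2 k 0).im =
          -(LeadGraph.cosSum a L k₀ L / LeadGraph.denom a L k₀) *
              LeadGraph.bracketOne a L L₁ L₂ k₀ k₁
            + LeadGraph.sinSum a L k₀ L / LeadGraph.denom a L k₀ *
              LeadGraph.bracketTwo a L L₁ L₂ k₀ k₁ ∧
        (iteratedDeriv 2 k 0).re =
          -(LeadGraph.sinSum a L k₀ L / LeadGraph.denom a L k₀) *
              LeadGraph.bracketOne a L L₁ L₂ k₀ k₁
            - LeadGraph.cosSum a L k₀ L / LeadGraph.denom a L k₀ *
              LeadGraph.bracketTwo a L L₁ L₂ k₀ k₁) ∧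
    -- the standard coupling has real coefficients that are independent of the momentum
    (W.IsStandard → ∃ a : G.IrrPseudoOrbit → ℝ,
      ∀ (γ : G.IrrPseudoOrbit) (z : ℂ), z ≠ 0 → γ.coeff W z = (a γ : ℂ)) := by
  refine ⟨?_, fun hW => ?_⟩
  · intro ℓ k₀ a L L₁ L₂ hℓ hpos hk₀ heig hA hL hL₁ hL₂ hd
    set c : G.IrrPseudoOrbit → ℂ := fun γ => (-1) ^ γ.count * a γ with hc
    set l : G.IrrPseudoOrbit → ℝ → ℝ := fun γ t => γ.length fun e => ℓ e t with hl
    have hlc : ∀ γ, ContDiffAt ℝ 2 (l γ) 0 := fun γ => γ.contDiffAt_length hℓ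
    have hLl : ∀ γ, l γ 0 = L γ := fun γ => (hL γ).symm
    have hres : ∀ᶠ z in 𝓝 (k₀ : ℂ), ∀ t, W.resonanceFunction (fun e => ℓ e t) z =
        ∑ γ, c γ * Complex.exp (Complex.I * z * l γ t) := by
      filter_upwards [eventually_all.2 hA] with z hz t
      simp only [LeadGraph.Coupling.resonanceFunction, hz, hc, hl]
    have hA0 : ∀ γ : G.IrrPseudoOrbit, γ.coeff W k₀ = a γ := fun γ => (hA γ).self_of_nhds
    -- With the scattering matrix frozen at the real momentum `k₀`, this holds for all `z`, so
    -- contractivity applies at complex `z`.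
    have hdet : ∀ (t : ℝ) (z : ℂ), ∑ γ, c γ * Complex.exp (Complex.I * z * l γ t) =
        (1 - W.bondScattering k₀ * Matrix.diagonal fun b : G.Bond =>
          Complex.exp (Complex.I * z * ℓ b.1 t)).det := by
      intro t z
      rw [← LeadGraph.sum_eq_det _ (fun _ _ => W.bondScattering_eq_zero k₀) (fun e => ℓ e t) z]
      refine Finset.sum_congr rfl fun γ _ => ?_
      rw [hc]
      dsimp only
      rw [← hA0]
      rfl
    have h0 : ∑ γ, c γ * Complex.exp (Complex.I * k₀ * l γ 0) = 0 := by
      rw [← hres.self_of_nhds 0]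
      exact heig.resonanceFunction_eq_zero hpos hk₀
    have h1 : ∑ γ, c γ * l γ 0 * Complex.exp (Complex.I * k₀ * l γ 0) ≠ 0 := by
      simp only [hLl, hc, LeadGraph.sum_mul_exp_eq]
      intro h
      have hre := congrArg Complex.re h
      have him := congrArg Complex.im h
      simp at hre him
      exact hd (by simp [LeadGraph.denom, hre, him])
    obtain ⟨φ, hφ0, hφ, hiff⟩ := exists_implicit_expSum hlc h0 h1
    have hball : ∀ᶠ p in 𝓝 ((0 : ℝ), (k₀ : ℂ)),
        W.resonanceFunction (fun e => ℓ e p.1) p.2 = 0 ↔ p.2 = φ p.1 := by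
      have : ∀ᶠ p in 𝓝 ((0 : ℝ), (k₀ : ℂ)), ∀ t, W.resonanceFunction (fun e => ℓ e t) p.2 =
          ∑ γ, c γ * Complex.exp (Complex.I * p.2 * l γ t) :=
        (continuous_snd.tendsto ((0 : ℝ), (k₀ : ℂ))).eventually hres
      filter_upwards [this, hiff] with p h1 h2
      rw [h1, h2]
    obtain ⟨δ, hδ, hδball⟩ := Metric.eventually_nhds_iff_ball.1 hball
    have hcont : Tendsto φ (𝓝 0) (𝓝 (k₀ : ℂ)) := hφ0 ▸ hφ.continuousAt
    obtain ⟨ε, hε, hεball⟩ := Metric.eventually_nhds_iff_ball.1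
      (hcont.eventually (Metric.ball_mem_nhds _ hδ))
    have hzero : ∀ᶠ t in 𝓝 (0 : ℝ), ∑ γ, c γ * Complex.exp (Complex.I * φ t * l γ t) = 0 := by
      have : Tendsto (fun t => (t, φ t)) (𝓝 0) (𝓝 ((0 : ℝ), (k₀ : ℂ))) :=
        tendsto_id.prodMk_nhds hcont
      filter_upwards [this.eventually hiff] with t ht
      exact ht.2 rfl
    have him : (deriv φ 0).im = 0 := by
      refine deriv_im_eq_zero_of_im_nonpos (hφ.differentiableAt (by simp)) (by simp [hφ0]) ?_
      have hpos' : ∀ᶠ t in 𝓝 (0 : ℝ), ∀ e, 0 < ℓ e t := eventually_all.2 fun e =>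
        (hℓ e).continuousAt.eventually (lt_mem_nhds (hpos e))
      filter_upwards [hzero, hpos'] with t ht htpos
      by_contra! hlt
      rw [hdet] at ht
      exact W.det_one_sub_ne_zero hk₀ htpos hlt ht
    have hk₁ : deriv φ 0 = ((deriv φ 0).re : ℂ) := Complex.ext rfl (by simpa using him)
    obtain ⟨hI, hII⟩ := expSum_deriv_identities hlc hφ hzero
    set k₁ := (deriv φ 0).re
    simp only [hk₁, hφ0, hLl, show ∀ γ, deriv (l γ) 0 = L₁ γ from fun γ => (hL₁ γ).symm,
      show ∀ γ, iteratedDeriv 2 (l γ) 0 = L₂ γ from fun γ => (hL₂ γ).symm] at hI hII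
    have hcos : k₁ * LeadGraph.cosSum a L k₀ L = -k₀ * LeadGraph.cosSum a L k₀ L₁ := by
      have e : ∑ γ, c γ * (Complex.exp (Complex.I * k₀ * L γ) *
          (Complex.I * (k₁ * L γ + k₀ * L₁ γ))) = Complex.I *
          (k₁ * ∑ γ, ((-1) ^ γ.count * a γ : ℂ) * L γ * Complex.exp (Complex.I * k₀ * L γ) +
          k₀ * ∑ γ, ((-1) ^ γ.count * a γ : ℂ) * L₁ γ * Complex.exp (Complex.I * k₀ * L γ)) := by
        simp only [Finset.mul_sum, ← Finset.sum_add_distrib]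
        exact Finset.sum_congr rfl fun γ _ => by rw [hc]; ring
      rw [hI, LeadGraph.sum_mul_exp_eq, LeadGraph.sum_mul_exp_eq] at e
      have := congrArg Complex.im e
      -- As `k₁` is real, the imaginary part of this identity contains only the cosine sums.
      simp at this
      linarith
    obtain ⟨hIm, hRe⟩ := LeadGraph.im_re_of_second_order_eq hd hII
    -- `|t| < ε` keeps `φ t` in the ball; `|t| < δ` keeps `(t, z)` in the product ball, whose metric
    -- is the maximum.
    refine ⟨φ, min ε δ, δ, k₁, lt_min hε hδ, hδ, hφ0, hφ, fun t ht => ?_, hk₁, hcos, fun hC => ?_, hIm, hRe⟩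
    · rw [lt_min_iff] at ht
      refine ⟨hεball t (by simpa using ht.1), fun z hz => hδball (t, z) ?_⟩
      rw [Metric.mem_ball, Prod.dist_eq]
      exact max_lt (by simpa using ht.2) hz
    · rw [← mul_div_assoc, eq_div_iff hC, hcos]
  · choose a ha using hW.coeff_eq
    exact ⟨a, ha⟩
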